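/- Let $F=(V,C)$ denote a CNF formula, where $V$ is a finite set of variables and $C$ is a finite multiset of non-empty clauses (sets of literals over $V$). Let $m=|C|$ be the number of clauses, counted with multiplicity, and let $\mathrm{sat}(F)$ be the maximum number of clauses of $C$ (counted with multiplicity) that are simultaneously satisfied by a truth assignment $V\to\{\text{true},\text{false}\}$. The parameterized problem SAT-A$(m/2)$ has as instances the pairs $(F,k)$, where $F$ is a CNF formula with $m$ clauses and the parameter $k$ is a nonnegative integer; $(F,k)$ is a yes-instance if and only if $\mathrm{sat}(F)\ge m/2+k$. **Theorem.** SAT-A$(m/2)$ has a proper kernel with at most $4k$ variables and at most $(2\sqrt5+4)k\le 8.473k$ clauses. That is, there is a polynomial-time algorithm that maps every instance $(F,k)$ of SAT-A$(m/2)$ to an instance $(F',k')$ of SAT-A$(m/2)$ such that 1. $(F,k)$ is a yes-instance if and only if $(F',k')$ is a yes-instance; 2. $k'\le k$; 3. the size of (the encoding of) $F'$ is at most $g(k)$ for some function $g:\mathbb N\to\mathbb N$; 4. $F'$ has at most $4k$ variables and at most $(2\sqrt5+4)k$ clauses, counted with multiplicity; and $(2\sqrt5+4)k\le 8.473k$ for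 every $k$. -/

import Mathlib

namespace SATKernel

/-! ### Computation model

Programs working on finite binary trees (Lisp-like data), with an explicit running time. Every
elementary step is charged one unit plus the size of the whole tree it works on, so each step can
be carried out by a Turing machine in time polynomial in its charge, and conversely a Turing
machine with its tapes stored as lists is simulated with polynomial overhead. Polynomial time in
this model is therefore polynomial time in the usual sense. -/

/-- Data: finite binary trees. A list is stored as nested `cons` cells ending in `nil`. -/
inductive Data : Type
  | nil : Data
  | cons (a b : Data) : Data

namespace Data

/-- Size of a tree: the number of its nodes. -/
def size : Data → ℕ
  | nil => 1
  | cons a b => size a + size b + 1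

/-- First component of a pair; `nil` on `nil`. -/
def head : Data → Data
  | nil => nil
  | cons a _ => a

/-- Second component of a pair; `nil` on `nil`. -/
def tail : Data → Data
  | nil => nil
  | cons _ b => b

/-- A truth value as data. -/
def ofBool : Bool → Data
  | false => nil
  | true => cons nil nil

/-- A list of data items as one data item. -/
def ofList : List Data → Data
  | [] => nil
  | a :: l => cons a (ofList l)

/-- A natural number in unary, as a list of `n` marks. -/
def ofUnary (n : ℕ) : Data := ofList (List.replicate n nil)

/-- A natural number in binary, as the list of its binary digits, least significant first. -/
def ofNat (n : ℕ) : Data := ofList (n.bits.map ofBool)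

end Data

/-- Programs, each of which transforms one piece of data. -/
inductive Prog : Type
  /-- return the input -/
  | id : Prog
  /-- return `nil` -/
  | nil : Prog
  /-- return the first component -/
  | head : Prog
  /-- return the second component -/
  | tail : Prog
  /-- run both programs on the input and pair their results -/
  | cons (p q : Prog) : Prog
  /-- run `p`, then run `q` on its result -/
  | seq (p q : Prog) : Prog
  /-- run the test `c` on the input; run `p` on the input if the result is not `nil`, else `q` -/
  | ite (c p q : Prog) : Prog
  /-- as long as the test `c` on the current data does not give `nil`, apply `p` to the data -/
  | loop (c p : Prog) : Prog

/-- `Runs p v w t`: started on the input `v`, the program `p` halts with output `w` at the total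
cost (running time) `t`. -/
inductive Runs : Prog → Data → Data → ℕ → Prop
  | id (v : Data) : Runs .id v v (v.size + 1)
  | nil (v : Data) : Runs .nil v .nil (v.size + 1)
  | head (v : Data) : Runs .head v v.head (v.size + 1)
  | tail (v : Data) : Runs .tail v v.tail (v.size + 1)
  | cons {p q : Prog} {v a b : Data} {s t : ℕ} (hp : Runs p v a s) (hq : Runs q v b t) :
      Runs (.cons p q) v (.cons a b) (s + t + v.size + 1)
  | seq {p q : Prog} {v w u : Data} {s t : ℕ} (hp : Runs p v w s) (hq : Runs q w u t) :
      Runs (.seq p q) v u (s + t + v.size + 1)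
  | ite_true {c p q : Prog} {v a b w : Data} {s t : ℕ} (hc : Runs c v (.cons a b) s)
      (hp : Runs p v w t) : Runs (.ite c p q) v w (s + t + v.size + 1)
  | ite_false {c p q : Prog} {v w : Data} {s t : ℕ} (hc : Runs c v .nil s)
      (hq : Runs q v w t) : Runs (.ite c p q) v w (s + t + v.size + 1)
  | loop_stop {c p : Prog} {v : Data} {s : ℕ} (hc : Runs c v .nil s) :
      Runs (.loop c p) v v (s + v.size + 1)
  | loop_step {c p : Prog} {v a b w u : Data} {s t r : ℕ} (hc : Runs c v (.cons a b) s)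
      (hp : Runs p v w t) (hl : Runs (.loop c p) w u r) :
      Runs (.loop c p) v u (s + t + r + v.size + 1)

/-- `f` is computable in polynomial time, for given encodings of its arguments and values: one
program computes it, within a number of steps polynomial in the size of the encoded argument. -/
def PolyTimeComputable {α β : Type} (encα : α → Data) (encβ : β → Data) (f : α → β) : Prop :=
  ∃ (p : Prog) (P : Polynomial ℕ),
    ∀ a : α, ∃ t ≤ P.eval (encα a).size, Runs p (encα a) (encβ (f a)) t

/-! ### Parameterized problems -/

/-- Encoding of an instance together with its parameter, the latter in binary. -/
def encodeParam {I : Type} (enc : I → Data) (x : I × ℕ) : Data :=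
  .cons (enc x.1) (Data.ofNat x.2)

/-- `κ` is a proper kernelization of the parameterized problem `L` (a set of pairs of an instance
and a parameter): it runs in polynomial time, maps an instance to an equivalent one, does not
increase the parameter, and yields instances (proper kernels) whose size is bounded by a function
of the parameter. -/
def IsProperKernelization {I : Type} (enc : I → Data) (L : Set (I × ℕ))
    (κ : I × ℕ → I × ℕ) : Prop :=
  PolyTimeComputable (encodeParam enc) (encodeParam enc) κ ∧
  (∀ x, x ∈ L ↔ κ x ∈ L) ∧
  (∀ x, (κ x).2 ≤ x.2) ∧
  ∃ g : ℕ → ℕ, ∀ x, (enc (κ x).1).size ≤ g x.2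

/-! ### CNF formulas -/

/-- A clause over the variables `0, …, n - 1`: a set of literals, where `(i, true)` is the
variable `i` and `(i, false)` its negation. -/
abbrev Clause (n : ℕ) : Type := Finset (Fin n × Bool)

/-- A CNF formula: a finite set of variables, named `0, …, numVars - 1` (they need not all occur
in clauses), and a finite multiset of non-empty clauses, listed in some order. A clause is
listed as many times as it appears. -/
structure CNF : Type where
  numVars : ℕ
  clauses : List (Clause numVars)
  nonempty_of_mem : ∀ c ∈ clauses, c.Nonempty

namespace CNF

/-- The number `m` of clauses, counted with multiplicity. -/
def numClauses (F : CNF) : ℕ := F.clauses.length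

/-- A truth assignment satisfies a clause if it makes one of its literals true. -/
def Satisfies {n : ℕ} (α : Fin n → Bool) (c : Clause n) : Prop :=
  ∃ l ∈ c, α l.1 = l.2

instance {n : ℕ} (α : Fin n → Bool) (c : Clause n) : Decidable (Satisfies α c) :=
  inferInstanceAs (Decidable (∃ l ∈ c, α l.1 = l.2))

/-- The number of clauses, counted with multiplicity, that a truth assignment satisfies. -/
def numSat (F : CNF) (α : Fin F.numVars → Bool) : ℕ :=
  F.clauses.countP (fun c => decide (Satisfies α c))

/-- `sat(F)`: the maximum number of clauses satisfied by a truth assignment. -/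
def sat (F : CNF) : ℕ := Finset.univ.sup F.numSat

/-- A clause as data: for each variable in turn, whether it occurs positively and whether it
occurs negatively. -/
def encodeClause {n : ℕ} (c : Clause n) : Data :=
  Data.ofList ((List.finRange n).map fun i =>
    .cons (Data.ofBool (decide ((i, true) ∈ c))) (Data.ofBool (decide ((i, false) ∈ c))))

/-- A formula as data: the list of its variables (one mark for each of them) and the list of its
clauses. -/
def encode (F : CNF) : Data :=
  .cons (Data.ofUnary F.numVars) (Data.ofList (F.clauses.map encodeClause))

end CNF

/-- The parameterized problem SAT-A(m/2): given a CNF formula `F` with `m` clauses and a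
nonnegative integer parameter `k`, decide whether `sat(F) ≥ m/2 + k`. -/
def SATAboveHalf : Set (CNF × ℕ) :=
  {x | (x.1.numClauses : ℝ) / 2 + (x.2 : ℝ) ≤ (x.1.sat : ℝ)}

end SATKernel

/-!
Two clauses `x` and `¬x` can be cancelled: exactly one of them is satisfied, whatever the
assignment. To reduce the number of variables, auction the `m` clauses among the variables: a
variable that owns nothing bids on a cheapest clause in which it occurs and raises its price by
one, until a variable without a clause occurs only in clauses of price more than `m`. One of the
prices `0, …, m` is not the price of any clause. All clauses above this gap can be satisfied by
their owners alone, and these owners occur in no clause below the gap, where they would rather have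
bid. So a clause above the gap needs only the literals on its owner, and then every variable that
still occurs owns a clause.

The reduced formula has no conflicting unit clauses. Setting its variables at random, with
probability `φ⁻¹` as its unit clauses want, satisfies at least `φ⁻¹ * m` clauses in expectation. On
the other hand, its `n` variables own distinct clauses, so that its clauses can be shortened to two
literals without losing a variable. If an assignment has a locally maximal number of clauses that
both it and its complement satisfy, every variable of a clause of size two lies in such a clause.
There are thus at least `n / 2` of them, counting unit clauses, which both assignments can respect,
and the better assignment satisfies `m / 2 + n / 4` clauses. Hence a formula with too many clauses
or variables is a yes-instance.
-/

namespace SATKernel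

open Polynomial

/-! ### Polynomial-time functions -/

theorem Data.size_head_le (d : Data) : d.head.size ≤ d.size := by
  cases d <;> simp only [Data.size, Data.head] <;> omega

theorem Data.size_tail_le (d : Data) : d.tail.size ≤ d.size := by
  cases d <;> simp only [Data.size, Data.tail] <;> omega

theorem Runs.size_le {p : Prog} {v w : Data} {t : ℕ} (h : Runs p v w t) : w.size ≤ t := by
  induction h with
  | head v => exact v.size_head_le.trans (Nat.le_succ _)
  | tail v => exact v.size_tail_le.trans (Nat.le_succ _)
  | nil v => exact Nat.le_add_left _ _
  | id v => exact Nat.le_succ _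
  | _ => (try simp only [Data.size] at *); omega

/-- A type with a standard encoding of its elements as data. Numbers are encoded in unary, since
they count variables and clauses; only the parameter of an instance is stored in binary. -/
class DataEncoding (α : Type) where
  toData : α → Data

open DataEncoding

instance : DataEncoding Unit := ⟨fun _ => .nil⟩
instance : DataEncoding Bool := ⟨Data.ofBool⟩
instance : DataEncoding ℕ := ⟨Data.ofUnary⟩

section
variable {α β : Type} [DataEncoding α] [DataEncoding β]

instance : DataEncoding (α × β) := ⟨fun x => .cons (toData x.1) (toData x.2)⟩
instance : DataEncoding (List α) := ⟨fun l => .ofList (l.map toData)⟩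
instance : DataEncoding (Option α) := ⟨fun o => toData o.toList⟩

/-- The size of the standard encoding of `a`. -/
def dataSize (a : α) : ℕ := (toData a).size

theorem toData_succ (n : ℕ) : toData (n + 1) = .cons .nil (toData n) := by
  simp only [toData, Data.ofUnary, List.replicate_succ, Data.ofList]

theorem toData_replicate_unit (n : ℕ) : toData (List.replicate n ()) = toData n := by
  simp only [toData, Data.ofUnary, List.map_replicate]

@[simp] theorem dataSize_prodMk (a : α) (b : β) :
    dataSize (a, b) = dataSize a + dataSize b + 1 := rfl

@[simp] theorem dataSize_nil : dataSize ([] : List α) = 1 := rfl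

@[simp] theorem dataSize_cons (a : α) (l : List α) :
    dataSize (a :: l) = dataSize a + dataSize l + 1 := rfl

theorem dataSize_bool_le (b : Bool) : dataSize b ≤ 3 := by
  cases b <;> decide

@[simp] theorem dataSize_nat (n : ℕ) : dataSize n = 2 * n + 1 := by
  induction n with
  | zero => rfl
  | succ n ih =>
    simp only [dataSize, toData_succ, Data.size] at ih ⊢
    omega

theorem dataSize_append_add_one (l l' : List α) :
    dataSize (l ++ l') + 1 = dataSize l + dataSize l' := by
  induction l with
  | nil => simp only [List.nil_append, dataSize_nil]; omega
  | cons a l ih => simp only [List.cons_append, dataSize_cons]; omega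

theorem length_lt_dataSize (l : List α) : l.length < dataSize l := by
  induction l with
  | nil => simp
  | cons a l ih => simp only [List.length_cons, dataSize_cons]; omega

theorem dataSize_le_of_mem {a : α} {l : List α} (h : a ∈ l) : dataSize a ≤ dataSize l := by
  induction h with
  | head l => simp only [dataSize_cons]; omega
  | tail b _ ih => simp only [dataSize_cons]; omega

theorem dataSize_le_of_sublist {l l' : List α} (h : l.Sublist l') :
    dataSize l ≤ dataSize l' := by
  induction h with
  | slnil => exact le_rfl
  | cons a _ ih => simp only [dataSize_cons]; omega
  | cons_cons a _ ih => simp only [dataSize_cons]; omega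

end

section
variable {α β γ σ : Type} [DataEncoding α] [DataEncoding β] [DataEncoding γ] [DataEncoding σ]

/-- Polynomial-time computability with respect to the standard encodings. -/
@[fun_prop]
def PolyTime (f : α → β) : Prop := PolyTimeComputable toData toData f

theorem monotone_eval_nat (P : ℕ[X]) : Monotone fun n => P.eval n := by
  intro a b h
  simp only [eval_eq_sum_range]
  gcongr

namespace PolyTime

theorem dataSize_le {f : α → β} (hf : PolyTime f) :
    ∃ P : ℕ[X], ∀ a, dataSize (f a) ≤ P.eval (dataSize a) := by
  obtain ⟨p, P, h⟩ := hf
  refine ⟨P, fun a => ?_⟩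
  obtain ⟨t, ht, hr⟩ := h a
  exact hr.size_le.trans ht

theorem of_toData_eq {f : α → β} (h : ∀ a, toData (f a) = toData a) : PolyTime f :=
  ⟨.id, X + 1, fun a => ⟨(toData a).size + 1, by simp, h a ▸ Runs.id _⟩⟩

theorem of_toData_eq_head {f : α → β} (h : ∀ a, toData (f a) = (toData a).head) : PolyTime f :=
  ⟨.head, X + 1, fun a => ⟨(toData a).size + 1, by simp, h a ▸ Runs.head _⟩⟩

theorem of_toData_eq_tail {f : α → β} (h : ∀ a, toData (f a) = (toData a).tail) : PolyTime f :=
  ⟨.tail, X + 1, fun a => ⟨(toData a).size + 1, by simp, h a ▸ Runs.tail _⟩⟩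

@[fun_prop]
theorem id : PolyTime fun a : α => a := of_toData_eq fun _ => rfl

@[fun_prop]
theorem comp {f : β → γ} {g : α → β} (hf : PolyTime f) (hg : PolyTime g) :
    PolyTime fun a => f (g a) := by
  obtain ⟨p, P, hp⟩ := hf
  obtain ⟨q, Q, hq⟩ := hg
  refine ⟨.seq q p, Q + P.comp Q + X + 1, fun a => ?_⟩
  obtain ⟨s, hs, hrs⟩ := hq a
  obtain ⟨t, ht, hrt⟩ := hp (g a)
  refine ⟨_, ?_, Runs.seq hrs hrt⟩
  have h_mono := monotone_eval_nat P (hrs.size_le.trans hs)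
  simp only [eval_add, eval_comp, eval_X, eval_one] at h_mono ⊢
  omega

@[fun_prop]
theorem prodMk {f : α → β} {g : α → γ} (hf : PolyTime f) (hg : PolyTime g) :
    PolyTime fun a => (f a, g a) := by
  obtain ⟨p, P, hp⟩ := hf
  obtain ⟨q, Q, hq⟩ := hg
  refine ⟨.cons p q, P + Q + X + 1, fun a => ?_⟩
  obtain ⟨s, hs, hrs⟩ := hp a
  obtain ⟨t, ht, hrt⟩ := hq a
  exact ⟨_, by simp only [eval_add, eval_X, eval_one]; omega, Runs.cons hrs hrt⟩

theorem comp₂ {f : α → β → γ} {g : σ → α} {h : σ → β}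
    (hf : PolyTime fun x : α × β => f x.1 x.2) (hg : PolyTime g) (hh : PolyTime h) :
    PolyTime fun a => f (g a) (h a) :=
  hf.comp (hg.prodMk hh)

theorem comp₃ {δ : Type} [DataEncoding δ] {f : α → β → γ → δ} {g : σ → α} {h : σ → β} {k : σ → γ}
    (hf : PolyTime fun x : α × β × γ => f x.1 x.2.1 x.2.2) (hg : PolyTime g) (hh : PolyTime h)
    (hk : PolyTime k) : PolyTime fun a => f (g a) (h a) (k a) :=
  hf.comp (hg.prodMk (hh.prodMk hk))

@[fun_prop]
theorem fst : PolyTime (Prod.fst : α × β → α) := of_toData_eq_head fun _ => rfl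

@[fun_prop]
theorem snd : PolyTime (Prod.snd : α × β → β) := of_toData_eq_tail fun _ => rfl

theorem exists_prog_const (d : Data) :
    ∃ (p : Prog) (P : ℕ[X]), ∀ v : Data, ∃ t ≤ P.eval v.size, Runs p v d t := by
  induction d with
  | nil => exact ⟨.nil, X + 1, fun v => ⟨_, by simp, Runs.nil v⟩⟩
  | cons a b iha ihb =>
    obtain ⟨p, P, hP⟩ := iha
    obtain ⟨q, Q, hQ⟩ := ihb
    refine ⟨.cons p q, P + Q + X + 1, fun v => ?_⟩
    obtain ⟨s, hs, hrs⟩ := hP v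
    obtain ⟨t, ht, hrt⟩ := hQ v
    exact ⟨_, by simp only [eval_add, eval_X, eval_one]; omega, Runs.cons hrs hrt⟩

@[fun_prop]
theorem const (b : β) : PolyTime fun _ : α => b := by
  obtain ⟨p, P, hp⟩ := exists_prog_const (toData b)
  exact ⟨p, P, fun a => hp _⟩

@[fun_prop]
theorem ite {c : α → Bool} {f g : α → β} (hc : PolyTime c) (hf : PolyTime f) (hg : PolyTime g) :
    PolyTime fun a => if c a then f a else g a := by
  obtain ⟨r, R, hr⟩ := hc
  obtain ⟨p, P, hp⟩ := hf
  obtain ⟨q, Q, hq⟩ := hg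
  refine ⟨.ite r p q, R + P + Q + X + 1, fun a => ?_⟩
  obtain ⟨u, hu, hru⟩ := hr a
  obtain ⟨s, hs, hrs⟩ := hp a
  obtain ⟨t, ht, hrt⟩ := hq a
  simp only [eval_add, eval_X, eval_one]
  cases h : c a <;> rw [h] at hru
  · exact ⟨_, by omega, Runs.ite_false hru hrt⟩
  · exact ⟨_, by omega, Runs.ite_true hru hrs⟩

@[fun_prop]
theorem bool_not {b : α → Bool} (hb : PolyTime b) : PolyTime fun a => !b a := by
  have h : PolyTime fun a => if b a then false else true := by fun_prop
  convert h using 2 with a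
  cases b a <;> rfl

@[fun_prop]
theorem bool_and {b c : α → Bool} (hb : PolyTime b) (hc : PolyTime c) :
    PolyTime fun a => b a && c a := by
  have h : PolyTime fun a => if b a then c a else false := by fun_prop
  convert h using 2 with a
  cases b a <;> rfl

@[fun_prop]
theorem bool_or {b c : α → Bool} (hb : PolyTime b) (hc : PolyTime c) :
    PolyTime fun a => b a || c a := by
  have h : PolyTime fun a => if b a then true else c a := by fun_prop
  convert h using 2 with a
  cases b a <;> rfl

@[fun_prop]
theorem bool_cond {b : α → Bool} {f g : α → β} (hb : PolyTime b) (hf : PolyTime f)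
    (hg : PolyTime g) : PolyTime fun a => cond (b a) (f a) (g a) := by
  simpa only [Bool.cond_eq_ite] using hb.ite hf hg

@[fun_prop]
theorem list_cons {f : α → β} {l : α → List β} (hf : PolyTime f) (hl : PolyTime l) :
    PolyTime fun a => f a :: l a :=
  comp (f := fun x : β × List β => x.1 :: x.2) (of_toData_eq fun _ => rfl) (hf.prodMk hl)

@[fun_prop]
theorem list_tail {l : α → List β} (hl : PolyTime l) : PolyTime fun a => (l a).tail :=
  comp (f := List.tail) (of_toData_eq_tail fun l => by cases l <;> rfl) hl

@[fun_prop]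
theorem option_toList {o : α → Option β} (ho : PolyTime o) : PolyTime fun a => (o a).toList :=
  comp (f := Option.toList) (of_toData_eq fun _ => rfl) ho

@[fun_prop]
theorem nat_succ {n : α → ℕ} (hn : PolyTime n) : PolyTime fun a => n a + 1 :=
  comp (f := fun x : Unit × ℕ => x.2 + 1) (of_toData_eq fun x => toData_succ x.2)
    ((const ()).prodMk hn)

@[fun_prop]
theorem nat_pred {n : α → ℕ} (hn : PolyTime n) : PolyTime fun a => n a - 1 :=
  comp (f := fun n : ℕ => n - 1)
    (of_toData_eq_tail fun n => by
      cases n with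
      | zero => rfl
      | succ n => rw [toData_succ]; rfl) hn

/-- One iteration of the program that folds a list. Its state consists of a context, the
accumulator and the rest of the list; `p` updates the accumulator. -/
def foldStep (p : Prog) : Prog :=
  .cons .head (.cons
    (.seq (.cons .head (.cons (.seq .tail .head) (.seq .tail (.seq .tail .head)))) p)
    (.seq .tail (.seq .tail .tail)))

theorem runs_foldStep {p : Prog} {c s a l w : Data} {t : ℕ}
    (h : Runs p (.cons c (.cons s a)) w t) :
    ∃ u ≤ t + 30 * (Data.cons c (.cons s (.cons a l))).size,
      Runs (foldStep p) (.cons c (.cons s (.cons a l))) (.cons c (.cons w l)) u := by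
  refine ⟨_, ?_, Runs.cons (Runs.head _) (Runs.cons (Runs.seq (Runs.cons (Runs.head _)
    (Runs.cons (Runs.seq (Runs.tail _) (Runs.head _)) (Runs.seq (Runs.tail _)
      (Runs.seq (Runs.tail _) (Runs.head _))))) h) (Runs.seq (Runs.tail _)
      (Runs.seq (Runs.tail _) (Runs.tail _))))⟩
  simp only [Data.size, Data.tail]
  omega

theorem runs_loop_foldStep {f : γ → σ → α → σ} {p : Prog} {P : ℕ[X]}
    (hp : ∀ x : γ × σ × α, ∃ t ≤ P.eval (dataSize x),
      Runs p (toData x) (toData (f x.1 x.2.1 x.2.2)) t)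
    (c : γ) (M : ℕ) (l : List α) (s : σ) (hM : dataSize c + dataSize l ≤ M)
    (hs : ∀ l₁, l₁ <+: l → dataSize (l₁.foldl (f c) s) ≤ M) :
    ∃ t ≤ (l.length + 1) * (P.eval (2 * M + 2) + 40 * (2 * M + 2)),
      Runs (.loop (.seq .tail .tail) (foldStep p)) (toData (c, s, l))
        (toData (c, l.foldl (f c) s, ([] : List α))) t := by
  have h_state : dataSize (c, s, l) ≤ 2 * M + 2 := by
    have := hs [] List.nil_prefix
    simp only [dataSize_prodMk, List.foldl_nil] at this ⊢
    omega
  have h_tail := (toData (c, s, l)).size_tail_le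
  induction l generalizing s with
  | nil =>
    refine ⟨_, ?_, Runs.loop_stop (Runs.seq (Runs.tail _) (Runs.tail _))⟩
    simp only [dataSize, List.length_nil] at h_state ⊢
    omega
  | cons a l ih =>
    have h_item : dataSize (c, s, a) ≤ 2 * M + 2 := by
      simp only [dataSize_prodMk, dataSize_cons] at h_state ⊢
      omega
    have h_next := hs [a] (by simp)
    obtain ⟨t, ht, hrt⟩ := hp (c, s, a)
    replace ht := ht.trans (monotone_eval_nat P h_item)
    obtain ⟨u, hu, hru⟩ := runs_foldStep (l := toData l) hrt
    obtain ⟨r, hr, hrr⟩ := ih (f c s a) (by simp only [dataSize_cons] at hM; omega)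
      (fun l₁ h => by simpa using hs (a :: l₁) (by simpa using h))
      (by simp only [dataSize_prodMk, dataSize_cons, List.foldl_cons, List.foldl_nil] at *; omega)
      (Data.size_tail_le _)
    refine ⟨_, ?_, Runs.loop_step (Runs.seq (Runs.tail _) (Runs.tail _)) hru hrr⟩
    change u ≤ t + 30 * (toData (c, s, a :: l)).size at hu
    simp only [dataSize] at h_state ht
    rw [List.length_cons, Nat.succ_mul]
    omega

theorem list_foldl_of_forall_prefix_dataSize_le {f : γ → σ → α → σ} {s : γ → σ} {l : γ → List α}
    (hf : PolyTime fun x : γ × σ × α => f x.1 x.2.1 x.2.2) (hs : PolyTime s) (hl : PolyTime l)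
    (hB : ∃ B : ℕ[X], ∀ c l₁, l₁ <+: l c →
      dataSize (l₁.foldl (f c) (s c)) ≤ B.eval (dataSize c)) :
    PolyTime fun c => (l c).foldl (f c) (s c) := by
  obtain ⟨L, hL⟩ := hl.dataSize_le
  obtain ⟨p, P, hp⟩ := hf
  obtain ⟨q, Q, hq⟩ := (PolyTime.id (α := γ)).prodMk (hs.prodMk hl)
  obtain ⟨B, hB⟩ := hB
  let M : ℕ[X] := X + L + B
  let T : ℕ[X] := L * (P.comp (2 * M + 2) + 40 * (2 * M + 2))
  refine ⟨.seq q (.seq (.loop (.seq .tail .tail) (foldStep p)) (.seq .tail .head)),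
    X + 4 * Q + 8 * T + 10, fun c => ?_⟩
  obtain ⟨t, ht, hrt⟩ := hq c
  obtain ⟨u, hu, hru⟩ := runs_loop_foldStep (P := P) hp c (M.eval (dataSize c)) (l c) (s c)
    (by simp only [M, eval_add, eval_X]; have := hL c; omega)
    (fun l₁ h => by simp only [M, eval_add, eval_X]; have := hB c l₁ h; omega)
  replace hu : u ≤ T.eval (dataSize c) := by
    refine hu.trans ?_
    simp only [T, eval_mul, eval_add, eval_comp, eval_ofNat]
    gcongr
    exact (length_lt_dataSize _).trans_le (hL c)
  refine ⟨_, ?_, Runs.seq hrt (Runs.seq hru (Runs.seq (Runs.tail _) (Runs.head _)))⟩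
  have h_start := hrt.size_le
  have h_end := hru.size_le
  have h_tail := (toData (c, (l c).foldl (f c) (s c), ([] : List α))).size_tail_le
  simp only [eval_add, eval_mul, eval_X, eval_ofNat]
  simp only [dataSize] at *
  omega

theorem list_foldl {f : γ → σ → α → σ} {s : γ → σ} {l : γ → List α}
    (hf : PolyTime fun x : γ × σ × α => f x.1 x.2.1 x.2.2) (hs : PolyTime s) (hl : PolyTime l)
    (hG : ∃ G : ℕ[X], ∀ c s a,
      dataSize (f c s a) ≤ dataSize s + G.eval (dataSize c + dataSize a)) :
    PolyTime fun c => (l c).foldl (f c) (s c) := by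
  obtain ⟨L, hL⟩ := hl.dataSize_le
  obtain ⟨S, hS⟩ := hs.dataSize_le
  obtain ⟨G, hG⟩ := hG
  have dataSize_foldl_le (c : γ) (l₁ : List α) (t : σ)
      (hl₁ : ∀ a ∈ l₁, dataSize a ≤ L.eval (dataSize c)) : dataSize (l₁.foldl (f c) t) ≤
        dataSize t + l₁.length * G.eval (dataSize c + L.eval (dataSize c)) := by
    induction l₁ generalizing t with
    | nil => simp
    | cons a l₁ ih =>
      have h_rest := ih (f c t a) fun b hb => hl₁ b (List.mem_cons_of_mem _ hb)
      have h_step := hG c t a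
      have h_mono := monotone_eval_nat G
        (Nat.add_le_add_left (hl₁ a List.mem_cons_self) (dataSize c))
      simp only at h_mono
      rw [List.foldl_cons, List.length_cons, Nat.succ_mul]
      omega
  refine list_foldl_of_forall_prefix_dataSize_le hf hs hl
    ⟨S + L * G.comp (X + L), fun c l₁ h => ?_⟩
  refine (dataSize_foldl_le c l₁ (s c)
    fun a ha => (dataSize_le_of_mem (h.subset ha)).trans (hL c)).trans ?_
  simp only [eval_add, eval_mul, eval_comp, eval_X]
  gcongr
  · exact hS c
  · exact h.length_le.trans ((length_lt_dataSize _).le.trans (hL c))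

@[fun_prop]
theorem list_reverse {l : γ → List α} (hl : PolyTime l) : PolyTime fun c => (l c).reverse := by
  have h := list_foldl (f := fun (_ : γ) s a => a :: s) (s := fun _ => []) (by fun_prop)
    (by fun_prop) hl
    ⟨X + 1, fun c s a => by simp only [dataSize_cons, eval_add, eval_X, eval_one]; omega⟩
  simpa using h

theorem list_foldr {f : γ → α → σ → σ} {s : γ → σ} {l : γ → List α}
    (hf : PolyTime fun x : γ × α × σ => f x.1 x.2.1 x.2.2) (hs : PolyTime s) (hl : PolyTime l)
    (hG : ∃ G : ℕ[X], ∀ c a s,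
      dataSize (f c a s) ≤ dataSize s + G.eval (dataSize c + dataSize a)) :
    PolyTime fun c => (l c).foldr (f c) (s c) := by
  obtain ⟨G, hG⟩ := hG
  have h := list_foldl (f := fun c s a => f c a s)
    (hf.comp₃ (g := fun x : γ × σ × α => x.1) (by fun_prop) (by fun_prop) (by fun_prop))
    hs hl.list_reverse ⟨G, fun c s a => hG c a s⟩
  simpa using h

theorem list_map {g : γ → α → β} {l : γ → List α} (hg : PolyTime fun x : γ × α => g x.1 x.2)
    (hl : PolyTime l) : PolyTime fun c => (l c).map (g c) := by
  obtain ⟨G, hG⟩ := hg.dataSize_le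
  have h := list_foldr (f := fun c a s => g c a :: s) (s := fun _ => [])
    ((hg.comp₂ (g := fun x : γ × α × List β => x.1) (by fun_prop) (by fun_prop)).list_cons
      (by fun_prop)) (by fun_prop) hl
    ⟨G.comp (X + 1) + 1, fun c a s => by
      have := hG (c, a)
      simp only [dataSize_prodMk, dataSize_cons, eval_add, eval_comp, eval_X, eval_one] at this ⊢
      omega⟩
  convert h using 2 with c
  exact List.map_eq_foldr

theorem list_any {p : γ → α → Bool} {l : γ → List α} (hp : PolyTime fun x : γ × α => p x.1 x.2)
    (hl : PolyTime l) : PolyTime fun c => (l c).any (p c) := by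
  have h := list_foldr (f := fun c a s => p c a || s) (s := fun _ => false)
    ((hp.comp₂ (g := fun x : γ × α × Bool => x.1) (by fun_prop) (by fun_prop)).bool_or
      (by fun_prop)) (by fun_prop) hl
    ⟨3, fun c a s => by simpa using (dataSize_bool_le _).trans (Nat.le_add_left _ _)⟩
  convert h using 2 with c
  induction l c with
  | nil => rfl
  | cons a l ih => rw [List.any_cons, ih, List.foldr_cons]

theorem list_all {p : γ → α → Bool} {l : γ → List α} (hp : PolyTime fun x : γ × α => p x.1 x.2)
    (hl : PolyTime l) : PolyTime fun c => (l c).all (p c) := by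
  have h := (list_any (p := fun c a => !p c a) hp.bool_not hl).bool_not
  simpa only [List.all_eq_not_any_not] using h

theorem list_filter {p : γ → α → Bool} {l : γ → List α}
    (hp : PolyTime fun x : γ × α => p x.1 x.2) (hl : PolyTime l) :
    PolyTime fun c => (l c).filter (p c) := by
  have h := list_foldr (f := fun c a s => if p c a then a :: s else s) (s := fun _ => [])
    ((hp.comp₂ (g := fun x : γ × α × List α => x.1) (by fun_prop) (by fun_prop)).ite
      (by fun_prop) (by fun_prop)) (by fun_prop) hl
    ⟨X + 1, fun c a s => by
      split <;> simp only [dataSize_cons, eval_add, eval_X, eval_one] <;> omega⟩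
  convert h using 2 with c
  induction l c with
  | nil => rfl
  | cons a l ih => rw [List.filter_cons, ih, List.foldr_cons]

@[fun_prop]
theorem list_length {l : γ → List α} (hl : PolyTime l) : PolyTime fun c => (l c).length := by
  have h := list_foldr (f := fun (_ : γ) (_ : α) (n : ℕ) => n + 1) (s := fun _ => 0)
    (by fun_prop) (by fun_prop) hl
    ⟨2, fun c a n => by simp only [dataSize_nat, eval_ofNat]; omega⟩
  convert h using 2 with c
  induction l c with
  | nil => rfl
  | cons a l ih => rw [List.length_cons, ih, List.foldr_cons]

@[fun_prop]
theorem list_append {l l' : γ → List α} (hl : PolyTime l) (hl' : PolyTime l') :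
    PolyTime fun c => l c ++ l' c := by
  have h := list_foldr (f := fun (_ : γ) (a : α) s => a :: s) (by fun_prop) hl' hl
    ⟨X + 1, fun c a s => by simp only [dataSize_cons, eval_add, eval_X, eval_one]; omega⟩
  simpa using h

@[fun_prop]
theorem list_head? {l : γ → List α} (hl : PolyTime l) : PolyTime fun c => (l c).head? := by
  have h := list_foldr (f := fun (_ : γ) (a : α) (_ : Option α) => some a) (s := fun _ => none)
    (comp (f := fun a => some a) ?_ (by fun_prop)) (by fun_prop) hl
    ⟨X + 2, fun c a o => ?_⟩
  · convert h using 2 with c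
    cases l c <;> rfl
  · have h : PolyTime fun a : α => [a] := by fun_prop
    exact h
  · have h : dataSize (some a) = dataSize a + 2 := rfl
    simp only [h, eval_add, eval_X, eval_ofNat]
    omega

theorem list_find? {p : γ → α → Bool} {l : γ → List α} (hp : PolyTime fun x : γ × α => p x.1 x.2)
    (hl : PolyTime l) : PolyTime fun c => (l c).find? (p c) := by
  simpa only [List.head?_filter] using (list_filter hp hl).list_head?

theorem list_findIdx {p : γ → α → Bool} {l : γ → List α}
    (hp : PolyTime fun x : γ × α => p x.1 x.2) (hl : PolyTime l) :
    PolyTime fun c => (l c).findIdx (p c) := by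
  have h := list_foldr (f := fun c a (n : ℕ) => if p c a then 0 else n + 1) (s := fun _ => 0)
    ((hp.comp₂ (g := fun x : γ × α × ℕ => x.1) (by fun_prop) (by fun_prop)).ite
      (by fun_prop) (by fun_prop)) (by fun_prop) hl
    ⟨2, fun c a n => by split <;> simp only [dataSize_nat, eval_ofNat] <;> omega⟩
  convert h using 2 with c
  induction l c with
  | nil => rfl
  | cons a l ih =>
    rw [List.findIdx_cons, ih, List.foldr_cons]
    cases p c a <;> rfl

theorem option_elim {o : γ → Option α} {d : γ → β} {f : γ → α → β} (ho : PolyTime o)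
    (hd : PolyTime d) (hf : PolyTime fun x : γ × α => f x.1 x.2) :
    PolyTime fun c => (o c).elim (d c) (f c) := by
  obtain ⟨G, hG⟩ := hf.dataSize_le
  have h := list_foldr (f := fun c a (_ : β) => f c a) (hf.comp₂ (g := fun x : γ × α × β => x.1)
    (by fun_prop) (by fun_prop)) hd ho.option_toList
    ⟨G.comp (X + 1), fun c a b => by
      have := hG (c, a)
      simp only [dataSize_prodMk, eval_comp, eval_add, eval_X, eval_one] at this ⊢
      omega⟩
  convert h using 2 with c
  cases o c <;> rfl

@[fun_prop]
theorem list_replicate_unit {n : γ → ℕ} (hn : PolyTime n) :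
    PolyTime fun c => List.replicate (n c) () :=
  comp (f := fun n => List.replicate n ()) (of_toData_eq toData_replicate_unit) hn

theorem iterate {f : γ → σ → σ} {s : γ → σ} {n : γ → ℕ}
    (hf : PolyTime fun x : γ × σ => f x.1 x.2) (hs : PolyTime s) (hn : PolyTime n)
    (hG : ∃ G : ℕ[X], ∀ c s, dataSize (f c s) ≤ dataSize s + G.eval (dataSize c)) :
    PolyTime fun c => (f c)^[n c] (s c) := by
  obtain ⟨G, hG⟩ := hG
  have h := list_foldr (f := fun c (_ : Unit) s => f c s)
    (hf.comp₂ (g := fun x : γ × Unit × σ => x.1) (by fun_prop) (by fun_prop)) hs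
    hn.list_replicate_unit
    ⟨G, fun c a s => (hG c s).trans (by gcongr; exact monotone_eval_nat G (Nat.le_add_right _ _))⟩
  convert h using 2 with c
  induction n c with
  | zero => rfl
  | succ n ih => rw [Function.iterate_succ_apply', ih, List.replicate_succ, List.foldr_cons]

@[fun_prop]
theorem nat_add {m n : γ → ℕ} (hm : PolyTime m) (hn : PolyTime n) :
    PolyTime fun c => m c + n c := by
  have h := iterate (f := fun (_ : γ) (s : ℕ) => s + 1) (by fun_prop) hm hn
    ⟨2, fun c s => by simp only [dataSize_nat, eval_ofNat]; omega⟩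
  simpa using h

@[fun_prop]
theorem nat_sub {m n : γ → ℕ} (hm : PolyTime m) (hn : PolyTime n) :
    PolyTime fun c => m c - n c := by
  have h := iterate (f := fun (_ : γ) (s : ℕ) => s - 1) (by fun_prop) hm hn
    ⟨0, fun c s => by simp⟩
  convert h using 2 with c
  exact (Nat.pred_iterate (m c) (n c)).symm

@[fun_prop]
theorem nat_mul {m n : γ → ℕ} (hm : PolyTime m) (hn : PolyTime n) :
    PolyTime fun c => m c * n c := by
  obtain ⟨M, hM⟩ := hm.dataSize_le
  have h := iterate (f := fun c (s : ℕ) => s + m c) (s := fun _ => 0)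
    (by fun_prop) (by fun_prop) hn
    ⟨M, fun c s => by have := hM c; simp only [dataSize_nat] at this ⊢; omega⟩
  convert h using 2 with c
  simp [mul_comm]

@[fun_prop]
theorem decide_le {m n : γ → ℕ} (hm : PolyTime m) (hn : PolyTime n) :
    PolyTime fun c => decide (m c ≤ n c) := by
  have h := list_all (p := fun (_ : γ) (_ : Unit) => false) (by fun_prop)
    (hm.nat_sub hn).list_replicate_unit
  convert h using 2 with c
  rw [Bool.eq_iff_iff]
  simp [Nat.sub_eq_zero_iff_le]

@[fun_prop]
theorem decide_lt {m n : γ → ℕ} (hm : PolyTime m) (hn : PolyTime n) :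
    PolyTime fun c => decide (m c < n c) :=
  decide_le (m := fun c => m c + 1) (by fun_prop) hn

@[fun_prop]
theorem decide_eq {m n : γ → ℕ} (hm : PolyTime m) (hn : PolyTime n) :
    PolyTime fun c => decide (m c = n c) := by
  simpa only [le_antisymm_iff, Bool.decide_and] using (hm.decide_le hn).bool_and (hn.decide_le hm)

@[fun_prop]
theorem nat_min {m n : γ → ℕ} (hm : PolyTime m) (hn : PolyTime n) :
    PolyTime fun c => min (m c) (n c) := by
  simpa only [min_def, decide_eq_true_eq] using (hm.decide_le hn).ite hm hn

@[fun_prop]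
theorem bool_toNat {b : γ → Bool} (hb : PolyTime b) : PolyTime fun c => (b c).toNat := by
  simpa only [Bool.toNat] using hb.bool_cond (const 1) (const 0)

@[fun_prop]
theorem list_drop {n : γ → ℕ} {l : γ → List α} (hn : PolyTime n) (hl : PolyTime l) :
    PolyTime fun c => (l c).drop (n c) := by
  have h := iterate (f := fun (_ : γ) (s : List α) => s.tail) (by fun_prop) hl hn
    ⟨0, fun c s => by
      cases s with
      | nil => exact Nat.le_add_right _ _
      | cons a s => simp only [List.tail_cons, dataSize_cons]; omega⟩
  convert h using 2 with c
  induction n c with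
  | zero => rfl
  | succ n ih => rw [Function.iterate_succ_apply', ← ih, List.tail_drop]

@[fun_prop]
theorem list_take {n : γ → ℕ} {l : γ → List α} (hn : PolyTime n) (hl : PolyTime l) :
    PolyTime fun c => (l c).take (n c) := by
  have h : PolyTime fun c => ((l c).reverse.drop ((l c).length - n c)).reverse := by fun_prop
  convert h using 2 with c
  rw [List.drop_reverse, List.reverse_reverse]
  rcases le_total (n c) (l c).length with h | h
  · rw [Nat.sub_sub_self h]
  · simp [h, List.take_of_length_le]

@[fun_prop]
theorem list_eraseIdx {l : γ → List α} {n : γ → ℕ} (hl : PolyTime l) (hn : PolyTime n) :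
    PolyTime fun c => (l c).eraseIdx (n c) := by
  simp only [List.eraseIdx_eq_take_drop_succ]
  fun_prop

@[fun_prop]
theorem list_getD {l : γ → List α} {n : γ → ℕ} {d : γ → α} (hl : PolyTime l) (hn : PolyTime n)
    (hd : PolyTime d) : PolyTime fun c => (l c).getD (n c) (d c) := by
  have h := option_elim (o := fun c => ((l c).drop (n c)).head?) (f := fun _ a => a)
    (by fun_prop) hd (by fun_prop)
  convert h using 2 with c
  rw [List.head?_drop, List.getD_eq_getElem?_getD]
  cases (l c)[n c]? <;> rfl

theorem list_modify {l : γ → List α} {n : γ → ℕ} {u : γ → α → α} (hl : PolyTime l)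
    (hn : PolyTime n) (hu : PolyTime fun x : γ × α => u x.1 x.2) :
    PolyTime fun c => (l c).modify (n c) (u c) := by
  have h : PolyTime fun c => (l c).take (n c) ++ ((((l c).drop (n c)).take 1).map (u c) ++
      (l c).drop (n c + 1)) :=
    (by fun_prop : PolyTime fun c => (l c).take (n c)).list_append
      ((list_map hu (by fun_prop)).list_append (by fun_prop))
  convert h using 2 with c
  rw [List.modify_eq_take_drop, ← List.drop_drop, List.append_cancel_left_eq]
  cases (l c).drop (n c) <;> rfl

@[fun_prop]
theorem list_range {n : γ → ℕ} (hn : PolyTime n) : PolyTime fun c => List.range (n c) := by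
  obtain ⟨N, hN⟩ := hn.dataSize_le
  -- The minimum does not change the value; it bounds the size of the new item.
  have h := iterate (f := fun c (s : List ℕ) => min s.length (n c) :: s) (s := fun _ => [])
    (by fun_prop) (by fun_prop) hn
    ⟨N + 1, fun c s => by
      have := hN c
      simp only [dataSize_nat, dataSize_cons, eval_add, eval_one] at this ⊢
      omega⟩
  convert h.list_reverse using 2 with c
  have iterate_eq (k : ℕ) (hk : k ≤ n c) :
      (fun s : List ℕ => min s.length (n c) :: s)^[k] [] = (List.range k).reverse := by
    induction k with
    | zero => rfl
    | succ k ih =>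
      rw [Function.iterate_succ_apply', ih (by omega), List.range_succ, List.reverse_append]
      simp [(Nat.le_of_succ_le hk)]
  rw [iterate_eq _ le_rfl, List.reverse_reverse]

end PolyTime

end

section
open Finset CNF

/-! ### Formulas without conflicting unit clauses -/

section
variable {ι : Type*} {n : ℕ} {c : ι → Clause n}

theorem CNF.Satisfies.mono {α : Fin n → Bool} {c d : Clause n} (h : Satisfies α c) (hcd : c ⊆ d) :
    Satisfies α d :=
  let ⟨l, hl, hαl⟩ := h
  ⟨l, hcd hl, hαl⟩

/-- No two unit clauses of the family contradict each other. -/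
def UnitConflictFree (c : ι → Clause n) : Prop :=
  ∀ a b x, c a = {(x, true)} → c b ≠ {(x, false)}

open Classical in
/-- The value that the unit clauses of the family prescribe for `x`, and `false` if there is no unit
clause on `x`. -/
noncomputable def unitSign (c : ι → Clause n) (x : Fin n) : Bool :=
  decide (∃ a, c a = {(x, true)})

theorem UnitConflictFree.unitSign_eq (hc : UnitConflictFree c) {a : ι} {l : Fin n × Bool}
    (h : c a = {l}) : unitSign c l.1 = l.2 := by
  classical
  obtain ⟨x, b⟩ := l
  cases b
  · exact decide_eq_false fun ⟨a', ha'⟩ => hc a' a x ha' h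
  · exact decide_eq_true ⟨a, h⟩

/-! #### Two assignments that share the clauses of a locally maximal cut -/

/-- The assignment makes a literal of the clause true and another one false (not-all-equal
satisfaction), so that both it and its complement satisfy the clause. -/
def NAESatisfies (α : Fin n → Bool) (c : Clause n) : Prop :=
  (∃ l ∈ c, α l.1 = l.2) ∧ ∃ l ∈ c, α l.1 = !l.2

theorem NAESatisfies.one_lt_card {α : Fin n → Bool} {c : Clause n} (h : NAESatisfies α c) :
    1 < #c := by
  obtain ⟨⟨l, hl, hαl⟩, l', hl', hαl'⟩ := h
  refine Finset.one_lt_card.2 ⟨l, hl, l', hl', ?_⟩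
  rintro rfl
  simp [hαl] at hαl'

theorem NAESatisfies.congr {α β : Fin n → Bool} {c : Clause n} (h : NAESatisfies α c)
    (hαβ : ∀ l ∈ c, α l.1 = β l.1) : NAESatisfies β c := by
  obtain ⟨⟨l, hl, hαl⟩, l', hl', hαl'⟩ := h
  exact ⟨⟨l, hl, hαβ l hl ▸ hαl⟩, l', hl', hαβ l' hl' ▸ hαl'⟩

theorem naeSatisfies_update_not {α : Fin n → Bool} {c : Clause n} {l : Fin n × Bool}
    (hc : 1 < #c) (hl : l ∈ c) (hα : ¬NAESatisfies α c) :
    NAESatisfies (Function.update α l.1 (!α l.1)) c := by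
  obtain ⟨l', hl', hne⟩ := exists_mem_ne hc l
  by_cases h_var : l'.1 = l.1
  · have h_compl : l'.2 = !l.2 := Bool.eq_not.2 fun h => hne (Prod.ext h_var h)
    refine absurd ?_ hα
    rcases Bool.eq_or_eq_not (α l.1) l.2 with h | h
    · exact ⟨⟨l, hl, h⟩, l', hl', by simp [h_var, h, h_compl]⟩
    · exact ⟨⟨l', hl', by simp [h_var, h, h_compl]⟩, l, hl, h⟩
  · rcases Bool.eq_or_eq_not (α l.1) l.2 with h | h <;>
      rcases Bool.eq_or_eq_not (α l'.1) l'.2 with h' | h'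
    · exact ⟨⟨l', hl', by simp [h_var, h']⟩, l, hl, by simp [h]⟩
    · exact absurd ⟨⟨l, hl, h⟩, l', hl', h'⟩ hα
    · exact absurd ⟨⟨l', hl', h'⟩, l, hl, h⟩ hα
    · exact ⟨⟨l, hl, by simp [h]⟩, l', hl', by simp [h_var, h']⟩

theorem exists_forall_mem_exists_naeSatisfies [Finite ι] (c : ι → Clause n) :
    ∃ α, ∀ a, 1 < #(c a) → ∀ l ∈ c a, ∃ a', NAESatisfies α (c a') ∧ ∃ b, (l.1, b) ∈ c a' := by
  classical
  cases nonempty_fintype ι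
  obtain ⟨α, -, h_max⟩ := exists_max_image univ (fun α => #{a | NAESatisfies α (c a)}) univ_nonempty
  refine ⟨α, fun a ha l hl => ?_⟩
  by_contra! h_none
  refine (h_max (Function.update α l.1 (!α l.1)) (mem_univ _)).not_gt (card_lt_card ?_)
  have hα : ¬NAESatisfies α (c a) := fun h => h_none a h l.2 hl
  refine Finset.ssubset_iff_subset_ne.2 ⟨fun a' ha' => ?_, fun h_eq => hα ?_⟩
  · simp only [mem_filter_univ] at ha' ⊢
    refine ha'.congr fun l' hl' => (Function.update_of_ne ?_ _ _).symm
    intro h_var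
    exact h_none a' ha' l'.2 (h_var ▸ hl')
  · have h_mem : a ∈ ({a | NAESatisfies (Function.update α l.1 (!α l.1)) (c a)} : Finset ι) := by
      simpa using naeSatisfies_update_not ha hl hα
    rw [← h_eq] at h_mem
    simpa using h_mem

theorem UnitConflictFree.exists_pair_satisfies [Finite ι] (hc : UnitConflictFree c)
    (hne : ∀ a, (c a).Nonempty) :
    ∃ α β, (∀ a, Satisfies α (c a) ∨ Satisfies β (c a)) ∧
      ∀ a, ∀ l ∈ c a, ∃ a', Satisfies α (c a') ∧ Satisfies β (c a') ∧ ∃ b, (l.1, b) ∈ c a' := by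
  classical
  obtain ⟨γ, hγ⟩ := exists_forall_mem_exists_naeSatisfies c
  let free : Set (Fin n) := {x | ∃ a, 1 < #(c a) ∧ ∃ b, (x, b) ∈ c a}
  let α := free.piecewise γ (unitSign c)
  let β := free.piecewise (fun x => !γ x) (unitSign c)
  have satisfies_of_notMem {a : ι} {l : Fin n × Bool} (hl : l ∈ c a) (hx : l.1 ∉ free) :
      Satisfies α (c a) ∧ Satisfies β (c a) := by
    have h_card : #(c a) ≤ 1 := not_lt.1 fun h => hx ⟨a, h, l.2, hl⟩
    have h_unit : c a = {l} :=
      eq_singleton_iff_unique_mem.2 ⟨hl, fun l' hl' => card_le_one.1 h_card l' hl' l hl⟩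
    exact ⟨⟨l, hl, by simp [α, hx, hc.unitSign_eq h_unit]⟩,
      ⟨l, hl, by simp [β, hx, hc.unitSign_eq h_unit]⟩⟩
  refine ⟨α, β, fun a => ?_, fun a l hl => ?_⟩
  · obtain ⟨l, hl⟩ := hne a
    by_cases hx : l.1 ∈ free
    · rcases Bool.eq_or_eq_not (γ l.1) l.2 with h | h
      · exact Or.inl ⟨l, hl, by simp [α, hx, h]⟩
      · exact Or.inr ⟨l, hl, by simp [β, hx, h]⟩
    · exact Or.inl (satisfies_of_notMem hl hx).1
  · by_cases hx : l.1 ∈ free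
    · obtain ⟨a₁, h_card, b, hb⟩ := hx
      obtain ⟨a', h_nae, h_mem⟩ := hγ a₁ h_card _ hb
      have h_free : ∀ l' ∈ c a', l'.1 ∈ free := fun l' hl' => ⟨a', h_nae.one_lt_card, l'.2, hl'⟩
      obtain ⟨⟨l₁, hl₁, hγ₁⟩, l₂, hl₂, hγ₂⟩ := h_nae
      exact ⟨a', ⟨l₁, hl₁, by simp [α, h_free l₁ hl₁, hγ₁]⟩,
        ⟨l₂, hl₂, by simp [β, h_free l₂ hl₂, hγ₂]⟩, h_mem⟩
    · exact ⟨a, (satisfies_of_notMem hl hx).1, (satisfies_of_notMem hl hx).2, l.2, hl⟩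

theorem UnitConflictFree.exists_two_mul_card_add_le_of_card_le_two [Fintype ι]
    (hc : UnitConflictFree c) (hne : ∀ a, (c a).Nonempty) (h_card : ∀ a, #(c a) ≤ 2)
    (h_occurs : ∀ x, ∃ a b, (x, b) ∈ c a) :
    ∃ α, 2 * Fintype.card ι + n ≤ 4 * #{a | Satisfies α (c a)} := by
  classical
  obtain ⟨α, β, h_or, h_and⟩ := hc.exists_pair_satisfies hne
  set A : Finset ι := {a | Satisfies α (c a)}
  set B : Finset ι := {a | Satisfies β (c a)}
  have h_union : #(A ∪ B) = Fintype.card ι := by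
    rw [← card_univ]
    congr 1
    ext a
    simpa [A, B] using h_or a
  have h_inter : n ≤ #(A ∩ B) * 2 := by
    have h_cover : (univ : Finset (Fin n)) ⊆ (A ∩ B).biUnion fun a => (c a).image Prod.fst := by
      intro x _
      obtain ⟨a, b, hx⟩ := h_occurs x
      obtain ⟨a', hα, hβ, b', hx'⟩ := h_and a _ hx
      exact mem_biUnion.2 ⟨a', by simp [A, B, hα, hβ], mem_image_of_mem Prod.fst hx'⟩
    calc n = #(univ : Finset (Fin n)) := (card_fin n).symm
      _ ≤ _ := card_le_card h_cover
      _ ≤ #(A ∩ B) * 2 := card_biUnion_le_card_mul _ _ _ fun a _ => card_image_le.trans (h_card a)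
  have h_sum := card_union_add_card_inter A B
  rcases le_total #A #B with h | h
  · exact ⟨β, by change _ ≤ 4 * #B; omega⟩
  · exact ⟨α, by change _ ≤ 4 * #A; omega⟩

theorem UnitConflictFree.exists_two_mul_card_add_le [Fintype ι] (hc : UnitConflictFree c)
    (hne : ∀ a, (c a).Nonempty) {own : Fin n → ι} (h_inj : own.Injective)
    (h_own : ∀ x, ∃ b, (x, b) ∈ c (own x)) :
    ∃ α, 2 * Fintype.card ι + n ≤ 4 * #{a | Satisfies α (c a)} := by
  classical
  choose sgn h_sgn using h_own
  let owned (a : ι) : Clause n := ({x | own x = a} : Finset (Fin n)).image fun x => (x, sgn x)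
  have owned_subset (a : ι) : owned a ⊆ c a := by
    simp only [owned, image_subset_iff, mem_filter_univ]
    rintro x rfl
    exact h_sgn x
  have card_owned_le (a : ι) : #(owned a) ≤ min 2 #(c a) := by
    refine le_min (card_image_le.trans ?_) (card_le_card (owned_subset a))
    refine (card_le_one.2 ?_).trans one_le_two
    simp only [mem_filter_univ]
    exact fun x hx y hy => h_inj (hx.trans hy.symm)
  choose u h_owned_u h_u_c h_card using fun a =>
    exists_subsuperset_card_eq (owned_subset a) (card_owned_le a) (min_le_right _ _)
  have u_nonempty (a : ι) : (u a).Nonempty := by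
    have := card_pos.2 (hne a)
    exact card_pos.1 (by have := h_card a; omega)
  have eq_singleton {a : ι} {l : Fin n × Bool} (h : u a = {l}) : c a = {l} := by
    rw [← h]
    refine (eq_of_subset_of_card_le (h_u_c a) ?_).symm
    have h_one : #(u a) = 1 := by rw [h, card_singleton]
    have := h_card a
    omega
  have hu : UnitConflictFree u := fun a b x ha hb => hc a b x (eq_singleton ha) (eq_singleton hb)
  obtain ⟨α, hα⟩ := hu.exists_two_mul_card_add_le_of_card_le_two u_nonempty
    (fun a => (h_card a).trans_le (min_le_left _ _))
    fun x => ⟨own x, sgn x, h_owned_u _ (mem_image_of_mem _ (by simp))⟩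
  refine ⟨α, hα.trans (Nat.mul_le_mul_left 4 (card_le_card ?_))⟩
  exact monotone_filter_right _ fun a _ h => h.mono (h_u_c a)

end

/-! #### A biased random assignment -/

theorem exists_card_le_of_forall_sum_le {ι Ω : Type*} [Fintype ι] [Fintype Ω] {W : Ω → ℝ}
    (hW : ∀ ω, 0 ≤ W ω) (h_sum : ∑ ω, W ω = 1) (bad : ι → Ω → Prop) [∀ a, DecidablePred (bad a)]
    {q : ℝ} (hq : ∀ a, ∑ ω with bad a ω, W ω ≤ q) :
    ∃ ω, (#{a | bad a ω} : ℝ) ≤ Fintype.card ι * q := by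
  have : Nonempty Ω := by
    by_contra! h
    simp at h_sum
  obtain ⟨ω, -, h_min⟩ := exists_min_image univ (fun ω => #{a | bad a ω}) univ_nonempty
  refine ⟨ω, ?_⟩
  calc (#{a | bad a ω} : ℝ) = ∑ ω', W ω' * #{a | bad a ω} := by
        rw [← sum_mul, h_sum, one_mul]
    _ ≤ ∑ ω', W ω' * #{a | bad a ω'} := by
        refine sum_le_sum fun ω' _ => mul_le_mul_of_nonneg_left ?_ (hW ω')
        exact_mod_cast h_min ω' (mem_univ _)
    _ = ∑ a, ∑ ω' with bad a ω', W ω' := by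
        simp only [sum_filter, ← sum_boole, mul_sum, mul_ite, mul_one, mul_zero]
        exact sum_comm
    _ ≤ Fintype.card ι * q := by
        simpa using sum_le_sum fun a (_ : a ∈ univ) => hq a

theorem sum_not_satisfies_prod_le {n : ℕ} {w : Fin n → Bool → ℝ} (hw : ∀ x b, 0 ≤ w x b)
    (h_sum : ∀ x, ∑ b, w x b = 1) {c S : Clause n} (hS : S ⊆ c)
    (h_inj : Set.InjOn Prod.fst (S : Set (Fin n × Bool))) :
    ∑ α with ¬Satisfies α c, ∏ x, w x (α x) ≤ ∏ l ∈ S, w l.1 (!l.2) := by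
  have filter_eq : ({α | ¬Satisfies α c} : Finset (Fin n → Bool)) =
      Fintype.piFinset fun x => {b | (x, b) ∉ c} := by
    ext α
    simp [Satisfies, Fintype.mem_piFinset]
  have sum_nonneg' (x : Fin n) : 0 ≤ ∑ b with (x, b) ∉ c, w x b := sum_nonneg fun b _ => hw x b
  have sum_le_one (x : Fin n) : ∑ b with (x, b) ∉ c, w x b ≤ 1 :=
    h_sum x ▸ sum_le_univ_sum_of_nonneg (hw x)
  calc ∑ α with ¬Satisfies α c, ∏ x, w x (α x)
      = ∏ x, ∑ b with (x, b) ∉ c, w x b := by rw [prod_univ_sum, filter_eq]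
    _ ≤ ∏ x ∈ S.image Prod.fst, ∑ b with (x, b) ∉ c, w x b :=
        prod_le_prod_of_subset_of_le_one (subset_univ _) (fun x _ => sum_nonneg' x)
          fun x _ _ => sum_le_one x
    _ = ∏ l ∈ S, ∑ b with (l.1, b) ∉ c, w l.1 b := prod_image h_inj
    _ ≤ ∏ l ∈ S, w l.1 (!l.2) := by
        refine prod_le_prod (fun l _ => sum_nonneg' l.1) fun l hl => ?_
        rw [← sum_singleton (w l.1) (!l.2)]
        refine sum_le_sum_of_subset_of_nonneg (fun b hb => ?_) fun b _ _ => hw l.1 b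
        rw [mem_filter_univ] at hb
        exact mem_singleton.2 (Bool.eq_not.2 fun h => hb (h ▸ hS hl))

section
variable {ι : Type*} {n : ℕ} {c : ι → Clause n}

/-- The probability that `x` takes the value `b` in the random assignment that follows the unit
clauses with probability `p`. -/
noncomputable def biasedWeight (c : ι → Clause n) (p : ℝ) (x : Fin n) (b : Bool) : ℝ :=
  if b = unitSign c x then p else 1 - p

theorem biasedWeight_nonneg {p : ℝ} (hp₀ : 0 ≤ p) (hp₁ : p ≤ 1) (x : Fin n) (b : Bool) :
    0 ≤ biasedWeight c p x b := by
  unfold biasedWeight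
  split_ifs
  exacts [hp₀, sub_nonneg.2 hp₁]

theorem sum_biasedWeight (c : ι → Clause n) (p : ℝ) (x : Fin n) :
    ∑ b, biasedWeight c p x b = 1 := by
  cases h : unitSign c x <;> simp [biasedWeight, h]

theorem UnitConflictFree.sum_not_satisfies_le {p : ℝ} (hp : 1 / 2 ≤ p) (hp_sq : p ^ 2 ≤ 1 - p)
    (hc : UnitConflictFree c) {a : ι} (hne : (c a).Nonempty) :
    ∑ α with ¬Satisfies α (c a), ∏ x, biasedWeight c p x (α x) ≤ 1 - p := by
  have hp_one : 0 ≤ 1 - p := (sq_nonneg p).trans hp_sq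
  have weight_nonneg := biasedWeight_nonneg (c := c) (by linarith) (sub_nonneg.1 hp_one)
  have weight_le (x : Fin n) (b : Bool) : biasedWeight c p x b ≤ p := by
    unfold biasedWeight
    split_ifs <;> linarith
  have sum_le {S : Clause n} := sum_not_satisfies_prod_le (c := c a) (S := S) weight_nonneg
    (sum_biasedWeight c p)
  by_cases h_distinct : ∃ l ∈ c a, ∃ l' ∈ c a, l.1 ≠ l'.1
  · obtain ⟨l, hl, l', hl', h_ne⟩ := h_distinct
    have h_pair : l ≠ l' := fun h => h_ne (congrArg Prod.fst h)
    refine (sum_le (S := {l, l'}) (by simp [insert_subset_iff, hl, hl']) ?_).trans ?_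
    · simp [Set.injOn_pair, h_ne]
    · rw [prod_pair h_pair]
      have := mul_le_mul (weight_le l.1 !l.2) (weight_le l'.1 !l'.2) (weight_nonneg _ _)
        (by linarith)
      linarith
  · push Not at h_distinct
    obtain ⟨l, hl⟩ := hne
    by_cases h_compl : (l.1, !l.2) ∈ c a
    · have satisfies (α : Fin n → Bool) : Satisfies α (c a) := by
        rcases Bool.eq_or_eq_not (α l.1) l.2 with h | h
        exacts [⟨l, hl, h⟩, ⟨_, h_compl, h⟩]
      simpa [satisfies] using hp_one
    · have h_unit : c a = {l} := by
        refine eq_singleton_iff_unique_mem.2 ⟨hl, fun l' hl' => ?_⟩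
        have h_var := h_distinct l' hl' l hl
        refine Prod.ext h_var (not_not.1 fun h => h_compl ?_)
        rwa [← h_var, ← Bool.eq_not.2 h]
      refine (sum_le (singleton_subset_iff.2 hl) (by simp)).trans_eq ?_
      simp [biasedWeight, hc.unitSign_eq h_unit]

open scoped goldenRatio in
theorem UnitConflictFree.exists_inv_goldenRatio_mul_card_le [Fintype ι] (hc : UnitConflictFree c)
    (hne : ∀ a, (c a).Nonempty) :
    ∃ α, φ⁻¹ * Fintype.card ι ≤ (#{a | Satisfies α (c a)} : ℝ) := by
  have h_sq : (φ⁻¹ : ℝ) ^ 2 = 1 - φ⁻¹ := by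
    rw [Real.inv_goldenRatio, neg_sq, Real.goldenConj_sq, sub_neg_eq_add, add_comm]
  have h_half : 1 / 2 ≤ (φ⁻¹ : ℝ) := by
    rw [one_div]
    exact inv_anti₀ Real.goldenRatio_pos Real.goldenRatio_lt_two.le
  have h_one : (φ⁻¹ : ℝ) ≤ 1 := sub_nonneg.1 (h_sq ▸ sq_nonneg _)
  have h_sum : ∑ α : Fin n → Bool, ∏ x, biasedWeight c φ⁻¹ x (α x) = 1 := by
    rw [← Fintype.prod_sum]
    exact prod_eq_one fun x _ => sum_biasedWeight c _ x
  obtain ⟨α, hα⟩ := exists_card_le_of_forall_sum_le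
    (fun α => prod_nonneg fun x _ => biasedWeight_nonneg (by linarith) h_one x (α x)) h_sum
    (fun a α => ¬Satisfies α (c a))
    fun a => hc.sum_not_satisfies_le h_half h_sq.le (hne a)
  refine ⟨α, ?_⟩
  have h_total : (#{a | Satisfies α (c a)} : ℝ) + #{a | ¬Satisfies α (c a)} = Fintype.card ι := by
    exact_mod_cast card_filter_add_card_filter_not (s := univ) _
  linarith

end

end

/-! ### Cancelling conflicting unit clauses -/

section
variable {α : Type} (r : α → α → Bool)

/-- Adds `a` to the list, unless the list has an item `r`-related to `a`: then the first such item
is removed instead. -/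
def cancelStep (a : α) (l : List α) : List α :=
  if l.findIdx (r a) < l.length then l.eraseIdx (l.findIdx (r a)) else a :: l

/-- Removes disjoint pairs of `r`-related items from a list until no two items are related. -/
def cancelPairs (l : List α) : List α := l.foldr (cancelStep r) []

variable {r}

theorem sum_map_cancelPairs {M : Type*} [AddCommMonoid M] {f : α → M}
    (hf : ∀ a b, r a b → f a + f b = 0) (l : List α) :
    ((cancelPairs r l).map f).sum = (l.map f).sum := by
  induction l with
  | nil => rfl
  | cons a l ih =>
    rw [List.map_cons, List.sum_cons, ← ih, cancelPairs, List.foldr_cons, ← cancelPairs]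
    unfold cancelStep
    split_ifs with h
    · rw [← ((List.getElem_cons_eraseIdx_perm h).map f).sum_eq, List.map_cons, List.sum_cons,
        ← add_assoc, hf _ _ List.findIdx_getElem, zero_add]
    · rw [List.map_cons, List.sum_cons]

theorem cancelPairs_sublist (l : List α) : (cancelPairs r l).Sublist l := by
  induction l with
  | nil => exact List.Sublist.refl _
  | cons a l ih =>
    rw [cancelPairs, List.foldr_cons, ← cancelPairs, cancelStep]
    split_ifs with h
    · exact ((List.eraseIdx_sublist _ _).trans ih).cons a
    · exact ih.cons_cons a

theorem pairwise_cancelPairs (l : List α) :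
    (cancelPairs r l).Pairwise fun a b => r a b = false := by
  induction l with
  | nil => exact List.Pairwise.nil
  | cons a l ih =>
    rw [cancelPairs, List.foldr_cons, ← cancelPairs, cancelStep]
    split_ifs with h
    · exact ih.sublist (List.eraseIdx_sublist _ _)
    · exact List.pairwise_cons.2 ⟨by simpa [List.findIdx_lt_length] using h, ih⟩

open Polynomial in
theorem polyTime_cancelPairs [DataEncoding α] (hr : PolyTime fun x : α × α => r x.1 x.2) :
    PolyTime (cancelPairs r) := by
  have h_idx : PolyTime fun x : List α × α × List α => x.2.2.findIdx (r x.2.1) :=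
    PolyTime.list_findIdx (hr.comp₂ (f := r)
      (g := fun x : (List α × α × List α) × α => x.1.2.1) (by fun_prop) (by fun_prop)) (by fun_prop)
  have h_step : PolyTime fun x : List α × α × List α => cancelStep r x.2.1 x.2.2 := by
    simpa only [cancelStep, decide_eq_true_eq] using
      (h_idx.decide_lt (n := fun x => x.2.2.length) (by fun_prop)).ite
        (PolyTime.list_eraseIdx (by fun_prop) h_idx) (by fun_prop)
  refine PolyTime.list_foldr (f := fun _ : List α => cancelStep r) h_step (by fun_prop)
    (by fun_prop) ⟨X + 1, fun c a s => ?_⟩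
  have := dataSize_le_of_sublist (List.eraseIdx_sublist s (s.findIdx (r a)))
  unfold cancelStep
  split_ifs <;> simp <;> omega

end

/-- A clause in the form in which it is encoded: the `i`-th item of the list tells whether the
literals `i` and `¬i` occur. -/
abbrev RawClause : Type := List (Bool × Bool)

/-- Which literals on the variable `i` occur in the clause: the positive and the negative one. -/
def lits (c : RawClause) (i : ℕ) : Bool × Bool := c.getD i (false, false)

/-- The literal that makes the variable `i` take the value `b` occurs in the clause. -/
def hasLit (c : RawClause) (i : ℕ) (b : Bool) : Bool := cond b (lits c i).1 (lits c i).2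

/-- The variable `i` occurs in the clause. -/
def occurs (i : ℕ) (c : RawClause) : Bool := hasLit c i true || hasLit c i false

/-- The clause consists of a single literal, which makes the variable `i` take the value `b`. -/
def isUnit (c : RawClause) (i : ℕ) (b : Bool) : Bool :=
  hasLit c i b && (List.range c.length).all fun j => [true, false].all fun d =>
    !hasLit c j d || (decide (j = i) && cond d b (!b))

/-- The clauses are unit clauses whose literals contradict each other. -/
def conflict (c d : RawClause) : Bool :=
  (List.range c.length).any fun i => [true, false].any fun b => isUnit c i b && isUnit d i !b

/-- A truth assignment satisfies a clause. -/
def rawSat (α : ℕ → Bool) (c : RawClause) : Bool :=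
  (List.range c.length).any fun i => hasLit c i (α i)

/-- No two clauses of the list conflict. -/
def ConflictFree (l : List RawClause) : Prop := ∀ c ∈ l, ∀ d ∈ l, conflict c d = false

/-- The contribution of a clause to the number of satisfied minus the number of falsified
clauses. -/
def balance (α : ℕ → Bool) (c : RawClause) : ℤ := if rawSat α c then 1 else -1

/-- Some truth assignment satisfies at least `m / 2 + k` of the `m` clauses of the list. -/
def AboveHalf (l : List RawClause) (k : ℕ) : Prop :=
  ∃ α : ℕ → Bool, 2 * (k : ℤ) ≤ (l.map (balance α)).sum

section
variable {c d : RawClause} {i : ℕ} {b : Bool}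

theorem lt_length_of_hasLit (h : hasLit c i b) : i < c.length := by
  by_contra! hi
  cases b <;> simp [hasLit, lits, hi] at h

theorem rawSat_iff {α : ℕ → Bool} : rawSat α c ↔ ∃ i, hasLit c i (α i) := by
  simp only [rawSat, List.any_eq_true, List.mem_range]
  exact ⟨fun ⟨i, _, h⟩ => ⟨i, h⟩, fun ⟨i, h⟩ => ⟨i, lt_length_of_hasLit h, h⟩⟩

theorem occurs_iff : occurs i c ↔ ∃ b, hasLit c i b := by
  simp [occurs, or_comm]

theorem isUnit_iff : isUnit c i b ↔ hasLit c i b ∧ ∀ j d, hasLit c j d → j = i ∧ d = b := by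
  have cond_iff (d : Bool) : cond d b (!b) = true ↔ d = b := by cases d <;> cases b <;> decide
  simp only [isUnit, Bool.and_eq_true, List.all_eq_true, List.mem_range, Bool.or_eq_true,
    Bool.not_eq_true', decide_eq_true_eq, cond_iff]
  refine and_congr_right fun _ => ⟨fun h j d hd => ?_, fun h j _ d _ => ?_⟩
  · exact (h j (lt_length_of_hasLit hd) d (by cases d <;> simp)).resolve_left (by simp [hd])
  · cases hd : hasLit c j d
    exacts [Or.inl rfl, Or.inr (h j d hd)]

theorem conflict_iff : conflict c d ↔ ∃ i b, isUnit c i b ∧ isUnit d i !b := by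
  simp only [conflict, List.any_eq_true, List.mem_range, Bool.and_eq_true]
  constructor
  · rintro ⟨i, _, b, _, h⟩
    exact ⟨i, b, h⟩
  · rintro ⟨i, b, h⟩
    exact ⟨i, lt_length_of_hasLit (isUnit_iff.1 h.1).1, b, by cases b <;> simp, h⟩

theorem rawSat_iff_of_isUnit {α : ℕ → Bool} (h : isUnit c i b) : rawSat α c ↔ α i = b := by
  obtain ⟨hb, h_unique⟩ := isUnit_iff.1 h
  rw [rawSat_iff]
  refine ⟨fun ⟨j, hj⟩ => ?_, fun h_eq => ⟨i, h_eq ▸ hb⟩⟩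
  obtain ⟨rfl, h_eq⟩ := h_unique j _ hj
  exact h_eq

theorem balance_add_balance_of_conflict {α : ℕ → Bool} (h : conflict c d) :
    balance α c + balance α d = 0 := by
  obtain ⟨i, b, hc, hd⟩ := conflict_iff.1 h
  simp only [balance, rawSat_iff_of_isUnit hc, rawSat_iff_of_isUnit hd]
  cases α i <;> cases b <;> rfl

theorem conflict_self : conflict c c = false := by
  refine Bool.eq_false_iff.2 fun h => ?_
  obtain ⟨i, b, hb, hnb⟩ := conflict_iff.1 h
  simpa using ((isUnit_iff.1 hb).2 i _ (isUnit_iff.1 hnb).1).2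

theorem conflict_symm (h : conflict c d) : conflict d c := by
  obtain ⟨i, b, hc, hd⟩ := conflict_iff.1 h
  exact conflict_iff.2 ⟨i, !b, hd, by rwa [Bool.not_not]⟩

theorem conflictFree_cancelPairs (l : List RawClause) : ConflictFree (cancelPairs conflict l) := by
  have : Std.Symm fun c d : RawClause => conflict c d = false :=
    ⟨fun _ _ h => Bool.eq_false_iff.2 fun h' => Bool.eq_false_iff.1 h (conflict_symm h')⟩
  intro c hc d hd
  exact (pairwise_cancelPairs l).forall_of_forall (fun _ _ => conflict_self) hc hd

theorem aboveHalf_cancelPairs (l : List RawClause) (k : ℕ) :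
    AboveHalf (cancelPairs conflict l) k ↔ AboveHalf l k := by
  simp only [AboveHalf, sum_map_cancelPairs (r := conflict)
    fun _ _ => balance_add_balance_of_conflict]

end

section
variable {γ : Type} [DataEncoding γ] {c d : γ → RawClause} {i : γ → ℕ} {b : γ → Bool}

@[fun_prop]
theorem polyTime_lits (hc : PolyTime c) (hi : PolyTime i) :
    PolyTime fun x => lits (c x) (i x) := by
  unfold lits
  fun_prop

@[fun_prop]
theorem polyTime_hasLit (hc : PolyTime c) (hi : PolyTime i) (hb : PolyTime b) :
    PolyTime fun x => hasLit (c x) (i x) (b x) := by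
  unfold hasLit
  fun_prop

@[fun_prop]
theorem polyTime_occurs (hi : PolyTime i) (hc : PolyTime c) :
    PolyTime fun x => occurs (i x) (c x) := by
  unfold occurs
  fun_prop

@[fun_prop]
theorem polyTime_isUnit (hc : PolyTime c) (hi : PolyTime i) (hb : PolyTime b) :
    PolyTime fun x => isUnit (c x) (i x) (b x) := by
  have h : PolyTime fun x : RawClause × ℕ × Bool => isUnit x.1 x.2.1 x.2.2 := by
    unfold isUnit
    exact PolyTime.bool_and (by fun_prop) <| PolyTime.list_all
      (PolyTime.list_all (by fun_prop) (by fun_prop)) (by fun_prop)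
  exact h.comp₃ hc hi hb

@[fun_prop]
theorem polyTime_conflict (hc : PolyTime c) (hd : PolyTime d) :
    PolyTime fun x => conflict (c x) (d x) := by
  have h : PolyTime fun x : RawClause × RawClause => conflict x.1 x.2 := by
    unfold conflict
    exact PolyTime.list_any (PolyTime.list_any (by fun_prop) (by fun_prop)) (by fun_prop)
  exact h.comp₂ hc hd

end

/-! ### The auction -/

/-- An item in an auction, with its current price and its current owner. An item of price `0` has
not been sold, and its `owner` field is meaningless. -/
structure Lot (α : Type) where
  price : ℕ
  owner : ℕ
  item : α

instance {α : Type} [DataEncoding α] : DataEncoding (Lot α) :=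
  ⟨fun e => toData (e.price, e.owner, e.item)⟩

section
variable {α : Type} (w : ℕ → α → Bool)

/-- The bidder `i` currently owns the lot. -/
def Lot.ownedBy (i : ℕ) (e : Lot α) : Bool := decide (0 < e.price) && decide (e.owner = i)

/-- The lot is a cheapest one among those that the bidder `i` wants, and its price has not reached
the cap. -/
def isTarget (S : List (Lot α)) (i : ℕ) (e : Lot α) : Bool :=
  w i e.item && decide (e.price ≤ S.length) &&
    S.all fun e' => !w i e'.item || decide (e.price ≤ e'.price)

/-- The bidder `i` owns nothing and has a lot to bid for. -/
def isActive (S : List (Lot α)) (i : ℕ) : Bool := !S.any (Lot.ownedBy i) && S.any (isTarget w S i)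

/-- The bidder `i` takes over a cheapest lot at a price raised by one. -/
def bid (S : List (Lot α)) (i : ℕ) : List (Lot α) :=
  S.modify (S.findIdx (isTarget w S i)) fun e => ⟨e.price + 1, i, e.item⟩

/-- The first active one of the `n` bidders makes a bid. -/
def auctionStep (n : ℕ) (S : List (Lot α)) : List (Lot α) :=
  ((List.range n).find? (isActive w S)).elim S (bid w S)

/-- The final state of an auction of the given items among `n` bidders, the bidder `i` being willing
to buy the items `a` with `w i a`. -/
def auction (n : ℕ) (l : List α) : List (Lot α) :=
  (auctionStep w n)^[l.length * (l.length + 1)] (l.map fun a => ⟨0, 0, a⟩)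

/-- A price that no lot has. -/
def priceGap (S : List (Lot α)) : ℕ :=
  (List.range (S.length + 1)).findIdx fun g => S.all fun e => !decide (e.price = g)

variable {w} {S : List (Lot α)} {e : Lot α} {i n : ℕ} {l : List α}

theorem Lot.ownedBy_iff : e.ownedBy i ↔ 0 < e.price ∧ e.owner = i := by
  simp [Lot.ownedBy]

theorem isTarget_iff : isTarget w S i e ↔
    (w i e.item ∧ e.price ≤ S.length) ∧ ∀ e' ∈ S, w i e'.item → e.price ≤ e'.price := by
  simp [isTarget, imp_iff_not_or]

theorem exists_bid_eq (h : isActive w S i) : ∃ A e B, S = A ++ e :: B ∧ isTarget w S i e ∧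
    bid w S i = A ++ ⟨e.price + 1, i, e.item⟩ :: B := by
  have h_lt : S.findIdx (isTarget w S i) < S.length :=
    List.findIdx_lt_length.2 (List.any_eq_true.1 (Bool.and_eq_true_iff.1 h).2)
  exact ⟨S.take _, S[S.findIdx (isTarget w S i)], S.drop _,
    by rw [← List.drop_eq_getElem_cons h_lt, List.take_append_drop],
    List.findIdx_getElem, List.modify_eq_take_cons_drop h_lt⟩

/-- The facts that every bid preserves. -/
structure AuctionInvariant (w : ℕ → α → Bool) (S : List (Lot α)) : Prop where
  wants_owner : ∀ e ∈ S, 0 < e.price → w e.owner e.item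
  price_le_succ : ∀ e ∈ S, ∀ e' ∈ S, 0 < e.price → w e.owner e'.item → e.price ≤ e'.price + 1
  pairwise_owner : S.Pairwise fun e e' => 0 < e.price → 0 < e'.price → e.owner ≠ e'.owner
  price_le : ∀ e ∈ S, e.price ≤ S.length + 1

namespace AuctionInvariant

theorem bid (hS : AuctionInvariant w S) (h : isActive w S i) :
    AuctionInvariant w (bid w S i) := by
  obtain ⟨A, e, B, h_eq, h_target, h_bid⟩ := exists_bid_eq h
  obtain ⟨⟨h_wants, h_le⟩, h_cheapest⟩ := isTarget_iff.1 h_target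
  have owner_ne (e' : Lot α) (he' : e' ∈ S) (h0 : 0 < e'.price) : e'.owner ≠ i := by
    intro h_owner
    simp only [isActive, Bool.and_eq_true, Bool.not_eq_true', List.any_eq_false] at h
    exact h.1 e' he' (Lot.ownedBy_iff.2 ⟨h0, h_owner⟩)
  have eq_or_mem (e' : Lot α) (he' : e' ∈ SATKernel.bid w S i) :
      e' = ⟨e.price + 1, i, e.item⟩ ∨ e' ∈ S := by
    rw [h_bid] at he'
    rw [h_eq]
    simp only [List.mem_append, List.mem_cons] at he' ⊢
    tauto
  have h_mem : e ∈ S := by simp [h_eq]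
  refine ⟨fun e₁ h₁ h0 => ?_, fun e₁ h₁ e₂ h₂ h0 hw => ?_, ?_, fun e₁ h₁ => ?_⟩
  · obtain rfl | h₁ := eq_or_mem e₁ h₁
    exacts [h_wants, hS.wants_owner e₁ h₁ h0]
  · obtain rfl | h₁ := eq_or_mem e₁ h₁ <;> obtain rfl | h₂ := eq_or_mem e₂ h₂
    · exact Nat.le_succ _
    · exact Nat.succ_le_succ (h_cheapest e₂ h₂ hw)
    · exact (hS.price_le_succ e₁ h₁ e h_mem h0 hw).trans (Nat.le_succ _)
    · exact hS.price_le_succ e₁ h₁ e₂ h₂ h0 hw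
  · have h_pairwise := hS.pairwise_owner
    rw [h_bid]
    rw [h_eq, List.pairwise_append, List.pairwise_cons] at h_pairwise
    rw [h_eq] at owner_ne
    rw [List.pairwise_append, List.pairwise_cons]
    obtain ⟨hA, ⟨-, hB⟩, hAB⟩ := h_pairwise
    refine ⟨hA, ⟨fun e' he' _ h0 => (owner_ne e' (by simp [he']) h0).symm, hB⟩,
      fun e₁ h₁ e₂ h₂ h0 h0' => ?_⟩
    obtain rfl | h₂ := List.mem_cons.1 h₂
    exacts [owner_ne e₁ (by simp [h₁]) h0, hAB e₁ h₁ e₂ (by simp [h₂]) h0 h0']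
  · rw [SATKernel.bid, List.length_modify]
    obtain rfl | h₁ := eq_or_mem e₁ h₁
    exacts [Nat.succ_le_succ h_le, hS.price_le e₁ h₁]

theorem eq_of_owner_eq (hS : AuctionInvariant w S) {e e' : Lot α} (he : e ∈ S) (he' : e' ∈ S)
    (h0 : 0 < e.price) (h0' : 0 < e'.price) (h : e.owner = e'.owner) : e = e' := by
  by_contra h_ne
  have : Std.Symm fun e e' : Lot α => 0 < e.price → 0 < e'.price → e.owner ≠ e'.owner :=
    ⟨fun _ _ h h0 h0' => (h h0' h0).symm⟩
  exact hS.pairwise_owner.forall he he' h_ne h0 h0' h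

end AuctionInvariant

theorem map_item_bid (h : isActive w S i) : (bid w S i).map Lot.item = S.map Lot.item := by
  obtain ⟨A, e, B, h_eq, -, h_bid⟩ := exists_bid_eq h
  rw [h_bid, h_eq]
  simp

theorem auctionStep_eq_or (n : ℕ) (S : List (Lot α)) :
    ((∀ i < n, ¬isActive w S i) ∧ auctionStep w n S = S) ∨
      ∃ i < n, isActive w S i ∧ auctionStep w n S = bid w S i := by
  unfold auctionStep
  cases h : (List.range n).find? (isActive w S) with
  | none => exact Or.inl ⟨by simpa using h, rfl⟩
  | some i =>
    exact Or.inr ⟨i, List.mem_range.1 (List.mem_of_find?_eq_some h), List.find?_some h, rfl⟩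

/-- The sum of the prices of the lots. -/
def totalPrice (S : List (Lot α)) : ℕ := (S.map Lot.price).sum

theorem totalPrice_bid (h : isActive w S i) : totalPrice (bid w S i) = totalPrice S + 1 := by
  obtain ⟨A, e, B, h_eq, -, h_bid⟩ := exists_bid_eq h
  rw [h_bid, h_eq]
  simp only [totalPrice, List.map_append, List.map_cons, List.sum_append, List.sum_cons]
  omega

theorem AuctionInvariant.totalPrice_le (hS : AuctionInvariant w S) :
    totalPrice S ≤ S.length * (S.length + 1) := by
  simpa [totalPrice] using
    List.sum_le_card_nsmul (S.map Lot.price) (S.length + 1) (by simpa using hS.price_le)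

theorem auctionInvariant_iterate_auctionStep (n t : ℕ) (l : List α) :
    AuctionInvariant w ((auctionStep w n)^[t] (l.map fun a => ⟨0, 0, a⟩)) := by
  induction t with
  | zero => exact ⟨by simp, by simp, by simp [List.pairwise_iff_getElem], by simp⟩
  | succ t ih =>
    rw [Function.iterate_succ_apply']
    obtain ⟨-, h⟩ | ⟨i, -, h_active, h⟩ := auctionStep_eq_or n _ <;> rw [h]
    exacts [ih, ih.bid h_active]

theorem map_item_iterate_auctionStep (n t : ℕ) (l : List α) :
    ((auctionStep w n)^[t] (l.map fun a => ⟨0, 0, a⟩)).map Lot.item = l := by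
  induction t with
  | zero => simp [Function.comp_def]
  | succ t ih =>
    rw [Function.iterate_succ_apply']
    obtain ⟨-, h⟩ | ⟨i, -, h_active, h⟩ := auctionStep_eq_or n _ <;> rw [h]
    exacts [ih, (map_item_bid h_active).trans ih]

theorem isFixedPt_iterate_of_eq_or_lt {σ : Type*} {f : σ → σ} {μ : σ → ℕ} {B : ℕ} {x : σ}
    (hf : ∀ y, f y = y ∨ μ y < μ (f y)) (hB : ∀ t, μ (f^[t] x) ≤ B) :
    Function.IsFixedPt f (f^[B] x) := by
  have fixed_or_le (t : ℕ) : f (f^[t] x) = f^[t] x ∨ t ≤ μ (f^[t] x) := by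
    induction t with
    | zero => exact Or.inr (Nat.zero_le _)
    | succ t ih =>
      rw [Function.iterate_succ_apply']
      rcases hf (f^[t] x) with h | h
      · exact Or.inl (congrArg f h)
      · refine ih.imp (congrArg f) fun h' => by omega
  rcases fixed_or_le B with h | h
  · exact h
  · refine (hf _).resolve_right fun h_lt => ?_
    have := hB (B + 1)
    rw [Function.iterate_succ_apply'] at this
    omega

theorem auctionInvariant_auction (n : ℕ) (l : List α) : AuctionInvariant w (auction w n l) :=
  auctionInvariant_iterate_auctionStep n _ l

theorem map_item_auction (n : ℕ) (l : List α) : (auction w n l).map Lot.item = l :=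
  map_item_iterate_auctionStep n _ l

theorem item_mem_of_mem_auction (he : e ∈ auction w n l) : e.item ∈ l :=
  map_item_auction (w := w) n l ▸ List.mem_map_of_mem he

theorem length_auction (n : ℕ) (l : List α) : (auction w n l).length = l.length := by
  conv_rhs => rw [← map_item_auction (w := w) n l, List.length_map]

theorem not_isActive_auction (l : List α) (hi : i < n) : ¬isActive w (auction w n l) i := by
  have h_fixed : auctionStep w n (auction w n l) = auction w n l := by
    refine isFixedPt_iterate_of_eq_or_lt (μ := totalPrice) (fun S => ?_) fun t => ?_
    · obtain ⟨-, h⟩ | ⟨i, -, h_active, h⟩ := auctionStep_eq_or n S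
      exacts [Or.inl h, Or.inr (by rw [h, totalPrice_bid h_active]; exact Nat.lt_succ_self _)]
    · have h_length := congrArg List.length (map_item_iterate_auctionStep (w := w) n t l)
      rw [List.length_map] at h_length
      exact h_length ▸ (auctionInvariant_iterate_auctionStep n t l).totalPrice_le
  obtain ⟨h, -⟩ | ⟨j, -, h_active, h⟩ := auctionStep_eq_or n (auction w n l)
  · exact h i hi
  · have := totalPrice_bid h_active
    rw [← h, h_fixed] at this
    omega

theorem exists_ownedBy_auction_or_length_lt_price (l : List α) (hi : i < n)
    (he : e ∈ auction w n l) (hw : w i e.item) :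
    (∃ e' ∈ auction w n l, e'.ownedBy i) ∨ l.length < e.price := by
  have h_passive := not_isActive_auction (w := w) l hi
  rw [← length_auction (w := w) n l]
  generalize auction w n l = S at *
  by_contra! h
  obtain ⟨m, ⟨hm, hwm⟩, h_min⟩ := Set.exists_min_image {e | e ∈ S ∧ w i e.item} Lot.price
    ((List.finite_toSet S).subset fun _ h => h.1) ⟨e, he, hw⟩
  refine h_passive (Bool.and_eq_true_iff.2 ⟨?_, List.any_eq_true.2 ⟨m, hm, isTarget_iff.2
    ⟨⟨hwm, (h_min e ⟨he, hw⟩).trans h.2⟩, fun e' he' hw' => h_min e' ⟨he', hw'⟩⟩⟩⟩)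
  simpa using h.1

theorem priceGap_le_length_and_ne_price (S : List (Lot α)) :
    priceGap S ≤ S.length ∧ ∀ e ∈ S, e.price ≠ priceGap S := by
  have h_lt : priceGap S < (List.range (S.length + 1)).length := by
    obtain ⟨g, hg, h_ne⟩ : ∃ g ∈ Finset.range (S.length + 1), g ∉ (S.map Lot.price).toFinset :=
      Finset.exists_mem_notMem_of_card_lt_card <|
        (List.toFinset_card_le _).trans_lt (by simp)
    exact List.findIdx_lt_length.2 ⟨g, by simpa using hg, by simpa using h_ne⟩
  have h_gap : S.all fun e => !decide (e.price = (List.range (S.length + 1))[priceGap S]) :=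
    List.findIdx_getElem (w := h_lt)
  rw [List.getElem_range] at h_gap
  rw [List.length_range] at h_lt
  exact ⟨Nat.le_of_lt_succ h_lt, by simpa using h_gap⟩

end

section
variable {α γ : Type} [DataEncoding α] [DataEncoding γ] {w : ℕ → α → Bool}
  {S : γ → List (Lot α)} {e : γ → Lot α} {i p o n : γ → ℕ} {a : γ → α} {l : γ → List α}

theorem dataSize_lot (e : Lot α) : dataSize e = dataSize (e.price, e.owner, e.item) := rfl

theorem polyTime_lot_fields : PolyTime fun e : Lot α => (e.price, e.owner, e.item) :=
  PolyTime.of_toData_eq fun _ => rfl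

@[fun_prop]
theorem polyTime_price (he : PolyTime e) : PolyTime fun c => (e c).price :=
  PolyTime.fst.comp (polyTime_lot_fields.comp he)

@[fun_prop]
theorem polyTime_owner (he : PolyTime e) : PolyTime fun c => (e c).owner :=
  (PolyTime.fst.comp PolyTime.snd).comp (polyTime_lot_fields.comp he)

@[fun_prop]
theorem polyTime_item (he : PolyTime e) : PolyTime fun c => (e c).item :=
  (PolyTime.snd.comp PolyTime.snd).comp (polyTime_lot_fields.comp he)

@[fun_prop]
theorem polyTime_lot (hp : PolyTime p) (ho : PolyTime o) (ha : PolyTime a) :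
    PolyTime fun c => Lot.mk (p c) (o c) (a c) :=
  (PolyTime.of_toData_eq (f := fun x : ℕ × ℕ × α => Lot.mk x.1 x.2.1 x.2.2) fun _ => rfl).comp
    (hp.prodMk (ho.prodMk ha))

@[fun_prop]
theorem polyTime_ownedBy (hi : PolyTime i) (he : PolyTime e) :
    PolyTime fun c => (e c).ownedBy (i c) := by
  unfold Lot.ownedBy
  fun_prop

theorem polyTime_isTarget (hw : PolyTime fun x : ℕ × α => w x.1 x.2) :
    PolyTime fun x : (List (Lot α) × ℕ) × Lot α => isTarget w x.1.1 x.1.2 x.2 := by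
  have wants {δ : Type} [DataEncoding δ] {i : δ → ℕ} {a : δ → α} (hi : PolyTime i)
      (ha : PolyTime a) : PolyTime fun x => w (i x) (a x) := hw.comp₂ hi ha
  unfold isTarget
  exact ((wants (by fun_prop) (by fun_prop)).bool_and (by fun_prop)).bool_and <|
    PolyTime.list_all ((wants (by fun_prop) (by fun_prop)).bool_not.bool_or (by fun_prop))
      (by fun_prop)

theorem polyTime_isActive (hw : PolyTime fun x : ℕ × α => w x.1 x.2) :
    PolyTime fun x : List (Lot α) × ℕ => isActive w x.1 x.2 :=
  (PolyTime.list_any (by fun_prop) (by fun_prop)).bool_not.bool_and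
    (PolyTime.list_any (polyTime_isTarget hw) (by fun_prop))

theorem polyTime_bid (hw : PolyTime fun x : ℕ × α => w x.1 x.2) :
    PolyTime fun x : List (Lot α) × ℕ => bid w x.1 x.2 :=
  PolyTime.list_modify (by fun_prop)
    (PolyTime.list_findIdx (polyTime_isTarget hw) (by fun_prop)) (by fun_prop)

theorem dataSize_auctionStep_le (n : ℕ) (S : List (Lot α)) :
    dataSize (auctionStep w n S) ≤ dataSize S + (2 * n + 2) := by
  obtain ⟨-, h⟩ | ⟨i, hi, h_active, h⟩ := auctionStep_eq_or (w := w) n S <;> rw [h]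
  · exact Nat.le_add_right _ _
  · obtain ⟨A, e, B, h_eq, -, h_bid⟩ := exists_bid_eq h_active
    have h_old := dataSize_append_add_one A (e :: B)
    have h_new := dataSize_append_add_one A (⟨e.price + 1, i, e.item⟩ :: B)
    rw [h_bid, h_eq]
    simp only [dataSize_cons, dataSize_lot, dataSize_prodMk, dataSize_nat] at h_old h_new
    omega

theorem polyTime_auction (hw : PolyTime fun x : ℕ × α => w x.1 x.2) (hn : PolyTime n)
    (hl : PolyTime l) : PolyTime fun c => auction w (n c) (l c) := by
  have h_step : PolyTime fun x : ℕ × List (Lot α) => auctionStep w x.1 x.2 :=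
    PolyTime.option_elim
      (PolyTime.list_find? ((polyTime_isActive hw).comp₂ (f := isActive w)
        (g := fun x : (ℕ × List (Lot α)) × ℕ => x.1.2) (by fun_prop) (by fun_prop)) (by fun_prop))
      (by fun_prop)
      ((polyTime_bid hw).comp₂ (f := bid w) (by fun_prop) (by fun_prop))
  have h : PolyTime fun x : ℕ × List α => auction w x.1 x.2 :=
    PolyTime.iterate (f := fun x : ℕ × List α => auctionStep w x.1)
      (h_step.comp₂ (f := auctionStep w) (by fun_prop) (by fun_prop))
      (PolyTime.list_map (by fun_prop) (by fun_prop)) (by fun_prop)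
      ⟨X + 1, fun ⟨n, l⟩ S => (dataSize_auctionStep_le _ _).trans (by
        simp only [dataSize_prodMk, dataSize_nat, eval_add, eval_X, eval_one]
        omega)⟩
  exact h.comp₂ hn hl

@[fun_prop]
theorem polyTime_priceGap (hS : PolyTime S) : PolyTime fun c => priceGap (S c) := by
  have h : PolyTime fun S : List (Lot α) => priceGap S :=
    PolyTime.list_findIdx (PolyTime.list_all (by fun_prop) (by fun_prop)) (by fun_prop)
  exact h.comp hS

end

/-! ### The reduced formula -/

/-- Deletes all literals except those on the variable `i`. -/
def restrictVar (i : ℕ) (c : RawClause) : RawClause :=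
  (List.range c.length).map fun j => if j = i then lits c j else (false, false)

/-- The clause of a lot, of which only the literals on its owner are kept if the price exceeds
`g`. -/
def prune (g : ℕ) (e : Lot RawClause) : RawClause :=
  if e.price ≤ g then e.item else restrictVar e.owner e.item

/-- The clause over new variables `j` that stand for the old ones `A[j]`. -/
def reindex (A : List ℕ) (c : RawClause) : RawClause := A.map (lits c)

/-- The bidders among the first `n` ones that own a lot. -/
def owners {α : Type} (n : ℕ) (S : List (Lot α)) : List ℕ :=
  (List.range n).filter fun i => S.any (Lot.ownedBy i)

/-- The formula with the clauses `l` in `n` variables after an auction of its clauses among its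
variables: only the owners remain as variables, and the clauses above the price gap keep only the
literals on their owners. -/
def reduce (n : ℕ) (l : List RawClause) : ℕ × List RawClause :=
  let S := auction occurs n l
  ((owners n S).length, (S.map (prune (priceGap S))).map (reindex (owners n S)))

/-- The clauses are the non-empty clauses of a formula in `n` variables. -/
def IsRawCNF (n : ℕ) (l : List RawClause) : Prop := ∀ c ∈ l, c.length = n ∧ ∃ i, occurs i c

/-- Distinct variables can be assigned distinct clauses in which they occur. -/
def IsOwned (n : ℕ) (l : List RawClause) : Prop :=
  ∃ own : Fin n → Fin l.length, own.Injective ∧ ∀ j : Fin n, occurs j (l.get (own j))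

theorem lits_map {A : List ℕ} {f : ℕ → Bool × Bool} {j : ℕ} (hj : j < A.length) :
    lits (A.map f) j = f A[j] := by
  simp [lits, hj]

theorem hasLit_reindex {A : List ℕ} {c : RawClause} {j : ℕ} {b : Bool} :
    hasLit (reindex A c) j b ↔ ∃ hj : j < A.length, hasLit c A[j] b := by
  constructor
  · intro h
    have hj : j < A.length := by simpa [reindex] using lt_length_of_hasLit h
    exact ⟨hj, by rwa [hasLit, reindex, lits_map hj] at h⟩
  · rintro ⟨hj, h⟩
    rwa [hasLit, reindex, lits_map hj]

theorem hasLit_restrictVar {i j : ℕ} {c : RawClause} {b : Bool} :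
    hasLit (restrictVar i c) j b ↔ j = i ∧ hasLit c j b := by
  have lits_restrictVar (hj : j < c.length) :
      lits (restrictVar i c) j = if j = i then lits c j else (false, false) := by
    rw [restrictVar, lits_map (by simpa using hj), List.getElem_range]
  constructor
  · intro h
    have hj : j < c.length := by simpa [restrictVar] using lt_length_of_hasLit h
    rw [hasLit, lits_restrictVar hj] at h
    split_ifs at h with h_eq
    exacts [⟨h_eq, h⟩, by cases b <;> simp at h]
  · rintro ⟨h_eq, h⟩
    rwa [hasLit, lits_restrictVar (lt_length_of_hasLit h), if_pos h_eq]

theorem AboveHalf.map_mono {ι : Type*} {S : List ι} {f h : ι → RawClause} {k : ℕ}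
    (H : ∀ α, ∃ β, ∀ e ∈ S, rawSat α (f e) → rawSat β (h e)) :
    AboveHalf (S.map f) k → AboveHalf (S.map h) k := by
  rintro ⟨α, hα⟩
  obtain ⟨β, hβ⟩ := H α
  refine ⟨β, hα.trans ?_⟩
  rw [List.map_map, List.map_map]
  refine List.sum_le_sum fun e he => ?_
  simp only [Function.comp_apply, balance]
  split_ifs with h₁ h₂ <;> first | omega | exact absurd (hβ e he h₁) h₂

section
variable {A : List ℕ} {l : List RawClause}

theorem aboveHalf_map_reindex (hA : A.Nodup) (hl : ∀ c ∈ l, ∀ i, occurs i c → i ∈ A) (k : ℕ) :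
    AboveHalf (l.map (reindex A)) k ↔ AboveHalf l k := by
  nth_rw 2 [← List.map_id l]
  refine ⟨AboveHalf.map_mono fun α => ⟨fun i => α (A.idxOf i), fun c _ h => ?_⟩,
    AboveHalf.map_mono fun α => ⟨fun j => α (A.getD j 0), fun c hc h => ?_⟩⟩
  · obtain ⟨j, hj⟩ := rawSat_iff.1 h
    obtain ⟨hj', h_lit⟩ := hasLit_reindex.1 hj
    exact rawSat_iff.2 ⟨A[j], by rwa [hA.idxOf_getElem]⟩
  · obtain ⟨i, hi⟩ := rawSat_iff.1 h
    obtain ⟨j, hj, rfl⟩ := List.getElem_of_mem (hl c hc i (occurs_iff.2 ⟨_, hi⟩))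
    exact rawSat_iff.2 ⟨j, hasLit_reindex.2 ⟨hj, by rwa [List.getD_eq_getElem A 0 hj]⟩⟩

theorem isUnit_of_isUnit_reindex {c : RawClause} {j : ℕ} {b : Bool}
    (hc : ∀ i, occurs i c → i ∈ A) (h : isUnit (reindex A c) j b) :
    ∃ hj : j < A.length, isUnit c A[j] b := by
  obtain ⟨h_lit, h_unique⟩ := isUnit_iff.1 h
  obtain ⟨hj, h_lit⟩ := hasLit_reindex.1 h_lit
  refine ⟨hj, isUnit_iff.2 ⟨h_lit, fun i d hd => ?_⟩⟩
  obtain ⟨j', hj', rfl⟩ := List.getElem_of_mem (hc i (occurs_iff.2 ⟨d, hd⟩))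
  obtain ⟨rfl, rfl⟩ := h_unique j' d (hasLit_reindex.2 ⟨hj', hd⟩)
  exact ⟨rfl, rfl⟩

theorem ConflictFree.map_reindex (h : ConflictFree l) (hl : ∀ c ∈ l, ∀ i, occurs i c → i ∈ A) :
    ConflictFree (l.map (reindex A)) := by
  simp only [ConflictFree, List.forall_mem_map, ← Bool.not_eq_true] at h ⊢
  intro c hc d hd h_conflict
  obtain ⟨j, b, hjc, hjd⟩ := conflict_iff.1 h_conflict
  obtain ⟨_, hc'⟩ := isUnit_of_isUnit_reindex (hl c hc) hjc
  obtain ⟨_, hd'⟩ := isUnit_of_isUnit_reindex (hl d hd) hjd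
  exact h c hc d hd (conflict_iff.2 ⟨_, b, hc', hd'⟩)

theorem isRawCNF_map_reindex (hl : ∀ c ∈ l, (∀ i, occurs i c → i ∈ A) ∧ ∃ i, occurs i c) :
    IsRawCNF A.length (l.map (reindex A)) := by
  refine List.forall_mem_map.2 fun c hc => ⟨List.length_map .., ?_⟩
  obtain ⟨h_mem, i, hi⟩ := hl c hc
  obtain ⟨j, hj, rfl⟩ := List.getElem_of_mem (h_mem i hi)
  obtain ⟨b, hb⟩ := occurs_iff.1 hi
  exact ⟨j, occurs_iff.2 ⟨b, hasLit_reindex.2 ⟨hj, hb⟩⟩⟩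

end

section
variable {S : List (Lot RawClause)} {e e' : Lot RawClause} {g i n : ℕ} {b : Bool}

theorem prune_of_le (h : e.price ≤ g) : prune g e = e.item := if_pos h

theorem hasLit_prune_of_lt (h : g < e.price) :
    hasLit (prune g e) i b ↔ i = e.owner ∧ hasLit e.item i b := by
  rw [prune, if_neg h.not_ge, hasLit_restrictVar]

theorem hasLit_of_hasLit_prune (h : hasLit (prune g e) i b) : hasLit e.item i b := by
  rcases le_or_gt e.price g with h_le | h_lt
  exacts [prune_of_le h_le ▸ h, ((hasLit_prune_of_lt h_lt).1 h).2]

theorem mem_owners {α : Type} {S : List (Lot α)} :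
    i ∈ owners n S ↔ i < n ∧ ∃ e ∈ S, 0 < e.price ∧ e.owner = i := by
  simp [owners, Lot.ownedBy_iff]

theorem nodup_owners {α : Type} (n : ℕ) (S : List (Lot α)) : (owners n S).Nodup :=
  List.nodup_range.filter _

namespace AuctionInvariant

theorem not_occurs_owner_of_lt {α : Type} {w : ℕ → α → Bool} {S : List (Lot α)} {e e' : Lot α}
    (hS : AuctionInvariant w S) (hg : ∀ e ∈ S, e.price ≠ g) (he : e ∈ S) (he' : e' ∈ S)
    (h_le : e.price ≤ g) (h_lt : g < e'.price) : ¬w e'.owner e.item := by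
  intro hw
  have := hS.price_le_succ e' he' e he (Nat.zero_lt_of_lt h_lt) hw
  have := hg e he
  omega

theorem occurs_owner_prune (hS : AuctionInvariant occurs S) (he : e ∈ S) (h : 0 < e.price)
    (g : ℕ) : occurs e.owner (prune g e) := by
  obtain ⟨b, hb⟩ := occurs_iff.1 (hS.wants_owner e he h)
  refine occurs_iff.2 ⟨b, ?_⟩
  rcases le_or_gt e.price g with h_le | h_lt
  exacts [(prune_of_le h_le).symm ▸ hb, (hasLit_prune_of_lt h_lt).2 ⟨rfl, hb⟩]

theorem exists_forall_rawSat_prune (hS : AuctionInvariant occurs S) (hg : ∀ e ∈ S, e.price ≠ g)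
    (α : ℕ → Bool) : ∃ β, ∀ e ∈ S, rawSat α e.item → rawSat β (prune g e) := by
  have exists_value (i : ℕ) : ∃ b, (∀ e ∈ S, g < e.price → e.owner = i → hasLit e.item i b) ∧
      (b = α i ∨ ∃ e ∈ S, g < e.price ∧ e.owner = i) := by
    by_cases h : ∃ e ∈ S, g < e.price ∧ e.owner = i
    · obtain ⟨e, he, h_lt, rfl⟩ := h
      obtain ⟨b, hb⟩ := occurs_iff.1 (hS.wants_owner e he (Nat.zero_lt_of_lt h_lt))
      refine ⟨b, fun e' he' h_lt' h_owner => ?_, Or.inr ⟨e, he, h_lt, rfl⟩⟩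
      rwa [hS.eq_of_owner_eq he' he (Nat.zero_lt_of_lt h_lt') (Nat.zero_lt_of_lt h_lt) h_owner]
    · exact ⟨α i, fun e he h_lt h_owner => absurd ⟨e, he, h_lt, h_owner⟩ h, Or.inl rfl⟩
  choose β h_lit h_eq using exists_value
  refine ⟨β, fun e he h_sat => rawSat_iff.2 ?_⟩
  rcases le_or_gt e.price g with h_le | h_lt
  · obtain ⟨i, hi⟩ := rawSat_iff.1 h_sat
    have h_value : β i = α i := by
      refine (h_eq i).resolve_right ?_
      rintro ⟨e', he', h_lt, rfl⟩
      exact hS.not_occurs_owner_of_lt hg he he' h_le h_lt (occurs_iff.2 ⟨_, hi⟩)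
    exact ⟨i, by rwa [prune_of_le h_le, h_value]⟩
  · exact ⟨e.owner, (hasLit_prune_of_lt h_lt).2 ⟨rfl, h_lit _ e he h_lt rfl⟩⟩

theorem aboveHalf_map_prune (hS : AuctionInvariant occurs S) (hg : ∀ e ∈ S, e.price ≠ g) (k : ℕ) :
    AboveHalf (S.map (prune g)) k ↔ AboveHalf (S.map Lot.item) k := by
  refine ⟨AboveHalf.map_mono fun α => ⟨α, fun e _ h => ?_⟩,
    AboveHalf.map_mono (hS.exists_forall_rawSat_prune hg)⟩
  obtain ⟨i, hi⟩ := rawSat_iff.1 h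
  exact rawSat_iff.2 ⟨i, hasLit_of_hasLit_prune hi⟩

theorem conflictFree_map_prune (hS : AuctionInvariant occurs S) (hg : ∀ e ∈ S, e.price ≠ g)
    (h : ConflictFree (S.map Lot.item)) : ConflictFree (S.map (prune g)) := by
  simp only [ConflictFree, List.forall_mem_map, ← Bool.not_eq_true] at h ⊢
  intro e he e' he' h_conflict
  wlog h_price : e.price ≤ e'.price generalizing e e'
  · exact this e' he' e he (conflict_symm h_conflict) (Nat.le_of_not_le h_price)
  obtain ⟨i, b, hi, hi'⟩ := conflict_iff.1 h_conflict
  have h_lit := (isUnit_iff.1 hi).1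
  rcases le_or_gt e'.price g with h_le' | h_lt'
  · rw [prune_of_le (h_price.trans h_le'), prune_of_le h_le'] at h_conflict
    exact h e he e' he' h_conflict
  obtain ⟨rfl, -⟩ := (hasLit_prune_of_lt h_lt').1 (isUnit_iff.1 hi').1
  rcases le_or_gt e.price g with h_le | h_lt
  · exact hS.not_occurs_owner_of_lt hg he he' h_le h_lt'
      (occurs_iff.2 ⟨b, hasLit_of_hasLit_prune h_lit⟩)
  · rw [hS.eq_of_owner_eq he' he (Nat.zero_lt_of_lt h_lt') (Nat.zero_lt_of_lt h_lt)
      ((hasLit_prune_of_lt h_lt).1 h_lit).1, conflict_self] at h_conflict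
    exact Bool.false_ne_true h_conflict

theorem isOwned_map_reindex_prune (hS : AuctionInvariant occurs S) (n g : ℕ) :
    IsOwned (owners n S).length ((S.map (prune g)).map (reindex (owners n S))) := by
  have exists_lot (j : Fin (owners n S).length) :
      ∃ a : Fin S.length, 0 < S[a].price ∧ S[a].owner = (owners n S)[j] := by
    obtain ⟨-, e, he, h0, h_owner⟩ := mem_owners.1 (List.getElem_mem (l := owners n S) j.2)
    obtain ⟨a, ha, rfl⟩ := List.getElem_of_mem he
    exact ⟨⟨a, ha⟩, h0, h_owner⟩
  choose own h0 h_owner using exists_lot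
  refine ⟨fun j => (own j).cast (by simp), fun j j' h => ?_, fun j => ?_⟩
  · have h_own : own j = own j' := by simpa using h
    exact Fin.ext ((nodup_owners n S).getElem_inj_iff.1
      ((h_owner j).symm.trans (h_own ▸ h_owner j')))
  · have h_occurs : occurs S[own j].owner (prune g S[own j]) :=
      hS.occurs_owner_prune (List.getElem_mem _) (h0 j) g
    obtain ⟨b, hb⟩ := occurs_iff.1 (h_owner j ▸ h_occurs)
    simpa using occurs_iff.2 ⟨b, hasLit_reindex.2 ⟨j.2, hb⟩⟩

end AuctionInvariant

end

section
variable {n : ℕ} {l : List RawClause}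

theorem mem_owners_of_occurs_prune (hl : ∀ c ∈ l, c.length = n) {e : Lot RawClause} {i : ℕ}
    (he : e ∈ auction occurs n l) (hi : occurs i (prune (priceGap (auction occurs n l)) e)) :
    i ∈ owners n (auction occurs n l) := by
  obtain ⟨b, hb⟩ := occurs_iff.1 hi
  have h_lit := hasLit_of_hasLit_prune hb
  have hi : i < n := hl _ (item_mem_of_mem_auction he) ▸ lt_length_of_hasLit h_lit
  refine mem_owners.2 ⟨hi, ?_⟩
  rcases le_or_gt e.price (priceGap (auction occurs n l)) with h_le | h_lt
  · have h_gap := (priceGap_le_length_and_ne_price (auction occurs n l)).1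
    rw [length_auction] at h_gap
    obtain ⟨e', he', h_owned⟩ := (exists_ownedBy_auction_or_length_lt_price l hi he
      (occurs_iff.2 ⟨b, h_lit⟩)).resolve_right (by omega)
    exact ⟨e', he', Lot.ownedBy_iff.1 h_owned⟩
  · exact ⟨e, he, Nat.zero_lt_of_lt h_lt, ((hasLit_prune_of_lt h_lt).1 hb).1.symm⟩

theorem isRawCNF_reduce (hl : IsRawCNF n l) : IsRawCNF (reduce n l).1 (reduce n l).2 := by
  refine isRawCNF_map_reindex (List.forall_mem_map.2 fun e he =>
    ⟨fun i => mem_owners_of_occurs_prune (fun c hc => (hl c hc).1) he, ?_⟩)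
  rcases le_or_gt e.price (priceGap (auction occurs n l)) with h_le | h_lt
  · rw [prune_of_le h_le]
    exact (hl _ (item_mem_of_mem_auction he)).2
  · exact ⟨_, (auctionInvariant_auction n l).occurs_owner_prune he (Nat.zero_lt_of_lt h_lt) _⟩

theorem aboveHalf_reduce (hl : ∀ c ∈ l, c.length = n) (k : ℕ) :
    AboveHalf (reduce n l).2 k ↔ AboveHalf l k := by
  have h_gap := (priceGap_le_length_and_ne_price (auction occurs n l)).2
  rw [reduce, aboveHalf_map_reindex (nodup_owners _ _)
    (List.forall_mem_map.2 fun e he i => mem_owners_of_occurs_prune hl he),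
    (auctionInvariant_auction n l).aboveHalf_map_prune h_gap, map_item_auction]

theorem conflictFree_reduce (hl : ∀ c ∈ l, c.length = n) (h : ConflictFree l) :
    ConflictFree (reduce n l).2 := by
  have h_gap := (priceGap_le_length_and_ne_price (auction occurs n l)).2
  refine ConflictFree.map_reindex ?_
    (List.forall_mem_map.2 fun e he i => mem_owners_of_occurs_prune hl he)
  exact (auctionInvariant_auction n l).conflictFree_map_prune h_gap
    ((map_item_auction n l).symm ▸ h)

theorem isOwned_reduce (n : ℕ) (l : List RawClause) : IsOwned (reduce n l).1 (reduce n l).2 :=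
  (auctionInvariant_auction n l).isOwned_map_reindex_prune n _

end

section
variable {γ : Type} [DataEncoding γ] {n : γ → ℕ} {l : γ → List RawClause}

theorem polyTime_restrictVar : PolyTime fun x : ℕ × RawClause => restrictVar x.1 x.2 := by
  have h : PolyTime fun x : (ℕ × RawClause) × ℕ =>
      if decide (x.2 = x.1.1) then lits x.1.2 x.2 else (false, false) :=
    PolyTime.ite (by fun_prop) (by fun_prop) (by fun_prop)
  simp only [decide_eq_true_eq] at h
  exact PolyTime.list_map h (by fun_prop)

theorem polyTime_prune : PolyTime fun x : ℕ × Lot RawClause => prune x.1 x.2 := by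
  have h : PolyTime fun x : ℕ × Lot RawClause =>
      if decide (x.2.price ≤ x.1) then x.2.item else restrictVar x.2.owner x.2.item :=
    PolyTime.ite (by fun_prop) (by fun_prop)
      (polyTime_restrictVar.comp₂ (f := restrictVar) (by fun_prop) (by fun_prop))
  simpa only [prune, decide_eq_true_eq] using h

theorem polyTime_owners {α : Type} [DataEncoding α] :
    PolyTime fun x : ℕ × List (Lot α) => owners x.1 x.2 :=
  PolyTime.list_filter (PolyTime.list_any (by fun_prop) (by fun_prop)) (by fun_prop)

theorem polyTime_reindex : PolyTime fun x : List ℕ × RawClause => reindex x.1 x.2 :=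
  PolyTime.list_map (by fun_prop) (by fun_prop)

@[fun_prop]
theorem polyTime_reduce (hn : PolyTime n) (hl : PolyTime l) :
    PolyTime fun c => reduce (n c) (l c) := by
  have h_auction := polyTime_auction (w := occurs) (by fun_prop) hn hl
  have h_owners := polyTime_owners.comp₂ (f := owners) hn h_auction
  have h_prune := PolyTime.list_map (g := fun c => prune (priceGap (auction occurs (n c) (l c))))
    (polyTime_prune.comp₂ (f := prune) (h_auction.comp PolyTime.fst |> polyTime_priceGap)
      PolyTime.snd) h_auction
  exact h_owners.list_length.prodMk <| PolyTime.list_map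
    (polyTime_reindex.comp₂ (f := reindex) (h_owners.comp PolyTime.fst) PolyTime.snd) h_prune

end

/-! ### Formulas and their encodings -/

/-- A clause in the form in which it is encoded. -/
def rawOf {n : ℕ} (c : Clause n) : RawClause :=
  (List.finRange n).map fun i => (decide ((i, true) ∈ c), decide ((i, false) ∈ c))

/-- The clauses of a formula in the form in which they are encoded. -/
def CNF.raw (F : CNF) : List RawClause := F.clauses.map rawOf

theorem hasLit_rawOf {n : ℕ} {c : Clause n} {i : ℕ} {b : Bool} :
    hasLit (rawOf c) i b ↔ ∃ hi : i < n, (⟨i, hi⟩, b) ∈ c := by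
  by_cases hi : i < n
  · cases b <;> simp [hasLit, lits, rawOf, hi]
  · cases b <;> simp [hasLit, lits, rawOf, hi]

theorem isUnit_rawOf_singleton {n : ℕ} {x : Fin n} {b : Bool} : isUnit (rawOf {(x, b)}) x b := by
  refine isUnit_iff.2 ⟨hasLit_rawOf.2 ⟨x.2, by simp⟩, fun j d hd => ?_⟩
  obtain ⟨hj, h_mem⟩ := hasLit_rawOf.1 hd
  simpa [Fin.ext_iff] using h_mem

theorem rawSat_rawOf {n : ℕ} {α : ℕ → Bool} {c : Clause n} :
    rawSat α (rawOf c) ↔ CNF.Satisfies (fun i => α i) c := by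
  simp only [rawSat_iff, hasLit_rawOf]
  constructor
  · rintro ⟨i, hi, h_mem⟩
    exact ⟨_, h_mem, rfl⟩
  · rintro ⟨⟨i, b⟩, h_mem, h_eq⟩
    exact ⟨i, i.2, (show α i = b from h_eq) ▸ h_mem⟩

theorem exists_rawOf_eq {n : ℕ} {d : RawClause} (hd : d.length = n) (h : ∃ i, occurs i d) :
    ∃ c : Clause n, c.Nonempty ∧ rawOf c = d := by
  subst hd
  obtain ⟨i, hi⟩ := h
  obtain ⟨b, hb⟩ := occurs_iff.1 hi
  refine ⟨Finset.univ.filter fun x => hasLit d x.1 x.2,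
    ⟨(⟨i, lt_length_of_hasLit hb⟩, b), by simpa using hb⟩, ?_⟩
  exact List.ext_getElem (by simp [rawOf]) fun j _ hj => by simp [rawOf, hasLit, lits]

namespace CNF

theorem exists_raw_eq {n : ℕ} {l : List RawClause} (hl : IsRawCNF n l) :
    ∃ F : CNF, (F.numVars, F.raw) = (n, l) := by
  choose! f h_nonempty hf using fun c hc => exists_rawOf_eq (hl c hc).1 (hl c hc).2
  refine ⟨⟨n, l.map f, List.forall_mem_map.2 h_nonempty⟩, ?_⟩
  have h_map : l.map (rawOf ∘ f) = l := (List.map_congr_left (g := id) hf).trans (List.map_id l)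
  rw [raw, List.map_map, h_map]

variable {F : CNF}

theorem length_raw : F.raw.length = F.numClauses := List.length_map ..

theorem isRawCNF_raw : IsRawCNF F.numVars F.raw := by
  refine List.forall_mem_map.2 fun c hc => ⟨by simp [rawOf], ?_⟩
  obtain ⟨⟨i, b⟩, h_mem⟩ := F.nonempty_of_mem c hc
  exact ⟨i, occurs_iff.2 ⟨b, hasLit_rawOf.2 ⟨i.2, h_mem⟩⟩⟩

theorem encode_eq_toData (F : CNF) : F.encode = toData (F.numVars, F.raw) := by
  simp only [encode, toData, raw, rawOf, List.map_map, Function.comp_def]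
  congr

theorem sum_balance_raw (F : CNF) (α : ℕ → Bool) :
    (F.raw.map (balance α)).sum = 2 * (F.numSat fun i => α i : ℤ) - F.numClauses := by
  simp only [raw, numSat, numClauses, List.map_map]
  induction F.clauses with
  | nil => simp
  | cons c l ih =>
    rw [List.map_cons, List.sum_cons, ih, List.countP_cons, List.length_cons]
    simp only [Function.comp_apply, balance, rawSat_rawOf, decide_eq_true_eq]
    split_ifs <;> push_cast <;> ring

theorem numSat_le_sat (α : Fin F.numVars → Bool) : F.numSat α ≤ F.sat :=
  Finset.le_sup (Finset.mem_univ α)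

theorem numSat_eq_card (α : Fin F.numVars → Bool) :
    F.numSat α = Finset.card {a | Satisfies α (F.clauses.get a)} := by
  rw [numSat]
  nth_rw 1 [← List.ofFn_get F.clauses]
  rw [← Multiset.coe_countP, ← Fin.univ_val_map, Multiset.countP_map]
  simp [Finset.card]

end CNF

section
variable {F : CNF} {k : ℕ}

theorem mem_satAboveHalf_iff :
    (F, k) ∈ SATAboveHalf ↔ F.numClauses + 2 * k ≤ 2 * F.sat := by
  rw [SATAboveHalf, Set.mem_ofPred_eq, ← @Nat.cast_le ℝ]
  push_cast
  constructor <;> intro h <;> linarith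

theorem mem_satAboveHalf_iff_aboveHalf : (F, k) ∈ SATAboveHalf ↔ AboveHalf F.raw k := by
  simp only [mem_satAboveHalf_iff, AboveHalf, CNF.sum_balance_raw]
  constructor
  · intro h
    obtain ⟨α, -, hα⟩ := Finset.exists_mem_eq_sup Finset.univ Finset.univ_nonempty F.numSat
    have h_sat : F.sat = F.numSat α := hα
    refine ⟨fun i => if hi : i < F.numVars then α ⟨i, hi⟩ else false, ?_⟩
    simp only [Fin.is_lt, dite_true, Fin.eta]
    change 2 * (k : ℤ) ≤ 2 * (F.numSat α : ℤ) - F.numClauses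
    omega
  · rintro ⟨α, hα⟩
    have := F.numSat_le_sat fun i => α i
    omega

theorem unitConflictFree_of_conflictFree (h : ConflictFree F.raw) :
    UnitConflictFree F.clauses.get := by
  intro a b x ha hb
  have raw_mem (a) : rawOf (F.clauses.get a) ∈ F.raw := List.mem_map_of_mem (List.get_mem _ a)
  refine Bool.eq_false_iff.1 (h _ (raw_mem a) _ (raw_mem b)) (conflict_iff.2 ⟨x, true, ?_⟩)
  rw [ha, hb]
  exact ⟨isUnit_rawOf_singleton, isUnit_rawOf_singleton⟩

theorem mem_satAboveHalf_of_lt_numVars (h : ConflictFree F.raw) (h_owned : IsOwned F.numVars F.raw)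
    (hk : 4 * k < F.numVars) : (F, k) ∈ SATAboveHalf := by
  obtain ⟨own, h_inj, h_own⟩ := h_owned
  have h_own (x : Fin F.numVars) :
      ∃ b, (x, b) ∈ F.clauses.get ((own x).cast CNF.length_raw) := by
    obtain ⟨b, hb⟩ := occurs_iff.1 (h_own x)
    have h_get : F.raw.get (own x) = rawOf (F.clauses.get ((own x).cast CNF.length_raw)) :=
      List.getElem_map ..
    exact ⟨b, (hasLit_rawOf.1 (h_get ▸ hb)).2⟩
  obtain ⟨α, hα⟩ := (unitConflictFree_of_conflictFree h).exists_two_mul_card_add_le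
    (fun a => F.nonempty_of_mem _ (List.get_mem _ a)) ((Fin.cast_injective _).comp h_inj) h_own
  rw [← CNF.numSat_eq_card, Fintype.card_fin] at hα
  have := F.numSat_le_sat α
  have : F.clauses.length = F.numClauses := rfl
  exact mem_satAboveHalf_iff.2 (by omega)

theorem mem_satAboveHalf_of_lt_numClauses (h : ConflictFree F.raw)
    (hk : (2 * √5 + 4) * k < F.numClauses) : (F, k) ∈ SATAboveHalf := by
  obtain ⟨α, hα⟩ := (unitConflictFree_of_conflictFree h).exists_inv_goldenRatio_mul_card_le
    fun a => F.nonempty_of_mem _ (List.get_mem _ a)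
  rw [← CNF.numSat_eq_card, Fintype.card_fin, Real.inv_goldenRatio, Real.goldenConj] at hα
  have h_sat : (F.numSat α : ℝ) ≤ F.sat := Nat.cast_le.2 (F.numSat_le_sat α)
  have h_sq : √5 ^ 2 = 5 := Real.sq_sqrt (by norm_num)
  have h_two : 2 < √5 := Real.lt_sqrt_of_sq_lt (by norm_num)
  calc (F.numClauses : ℝ) / 2 + k
      = F.numClauses / 2 + (√5 - 2) / 2 * ((2 * √5 + 4) * k) := by linear_combination -k * h_sq
    _ ≤ F.numClauses / 2 + (√5 - 2) / 2 * F.numClauses := by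
      have := sub_pos.2 h_two
      gcongr
    _ = -((1 - √5) / 2) * F.numClauses := by ring
    _ ≤ F.sat := hα.trans h_sat

theorem le_numClauses_of_mem_satAboveHalf (h : (F, k) ∈ SATAboveHalf) : k ≤ F.numClauses := by
  have h_sat : F.sat ≤ F.numClauses := Finset.sup_le fun α _ => List.countP_le_length
  have := mem_satAboveHalf_iff.1 h
  omega

end

/-! ### The kernelization -/

/-- The minimum of `N` and the number with binary digits `l`. The parameter is exponentially large
in its encoding, so that only such a bounded part of it can be handled in unary. -/
def cappedVal (N : ℕ) (l : List Bool) : ℕ := l.foldr (fun b v => min N (2 * v + b.toNat)) 0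

/-- The formula satisfies the bounds on the size of a kernel for the parameter `k`. -/
def fits (k : ℕ) (F : ℕ × List RawClause) : Bool :=
  decide (F.1 ≤ 4 * k) &&
    decide ((F.2.length - 4 * k) * (F.2.length - 4 * k) ≤ 20 * (k * k))

/-- The kernelization on encoded instances: a constant no-instance if the parameter exceeds the
number of clauses, otherwise the reduced formula if it is small enough and a constant yes-instance
if it is not. -/
def kernel (x : (ℕ × List RawClause) × List Bool) : (ℕ × List RawClause) × List Bool :=
  if decide (cappedVal (x.1.2.length + 1) x.2 ≤ x.1.2.length) then
    if fits (cappedVal (x.1.2.length + 1) x.2) (reduce x.1.1 (cancelPairs conflict x.1.2)) then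
      (reduce x.1.1 (cancelPairs conflict x.1.2), x.2)
    else ((0, []), [])
  else ((0, []), [true])

/-- The formula without variables and clauses. -/
def CNF.empty : CNF := ⟨0, [], List.forall_mem_nil _⟩

section
variable {γ : Type} [DataEncoding γ] {N k : γ → ℕ}

@[fun_prop]
theorem polyTime_cappedVal {l : γ → List Bool} (hN : PolyTime N) (hl : PolyTime l) :
    PolyTime fun c => cappedVal (N c) (l c) := by
  obtain ⟨P, hP⟩ := hN.dataSize_le
  refine PolyTime.list_foldr (f := fun c b v => min (N c) (2 * v + b.toNat)) (s := fun _ => 0)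
    (by fun_prop) (by fun_prop) hl ⟨P, fun c b v => ?_⟩
  have := (hP c).trans (monotone_eval_nat P (Nat.le_add_right _ (dataSize b)))
  simp only [dataSize_nat] at this ⊢
  omega

@[fun_prop]
theorem polyTime_fits {F : γ → ℕ × List RawClause} (hk : PolyTime k) (hF : PolyTime F) :
    PolyTime fun c => fits (k c) (F c) := by
  unfold fits
  fun_prop

theorem polyTime_kernel : PolyTime kernel := by
  have h_cancel : PolyTime (cancelPairs conflict) :=
    polyTime_cancelPairs (r := conflict) (by fun_prop)
  unfold kernel
  fun_prop

end

theorem cappedVal_bits (N k : ℕ) : cappedVal N k.bits = min N k := by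
  rw [cappedVal]
  induction k using Nat.binaryRec' with
  | zero => simp
  | bit b n h ih =>
    rw [Nat.bits_append_bit n b h, List.foldr_cons, ih, Nat.bit_val]
    omega

theorem fits_iff {k : ℕ} {F : ℕ × List RawClause} :
    fits k F ↔ F.1 ≤ 4 * k ∧ (F.2.length : ℝ) ≤ (2 * √5 + 4) * k := by
  simp only [fits, Bool.and_eq_true, decide_eq_true_eq]
  refine and_congr_right fun _ => ?_
  generalize F.2.length = m
  have h_sq : 20 * ((k : ℝ) * k) = (2 * √5 * k) ^ 2 := by
    linear_combination -4 * (k : ℝ) ^ 2 * Real.sq_sqrt (show (0 : ℝ) ≤ 5 by norm_num)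
  rcases le_total m (4 * k) with h | h
  · have h_le : (m : ℝ) ≤ 4 * k := by exact_mod_cast h
    have h_nonneg : 0 ≤ 2 * √5 * k := by positivity
    simp only [Nat.sub_eq_zero_of_le h, zero_mul, zero_le, true_iff]
    linarith
  · obtain ⟨d, rfl⟩ := Nat.exists_eq_add_of_le h
    rw [Nat.add_sub_cancel_left, ← @Nat.cast_le ℝ]
    push_cast
    rw [h_sq, ← sq, sq_le_sq₀ (by positivity) (by positivity), add_mul, add_comm,
      add_le_add_iff_right]

section
variable {n k : ℕ} {l : List RawClause}

theorem kernel_of_length_lt (h : l.length < k) : kernel ((n, l), k.bits) = ((0, []), [true]) := by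
  simp only [kernel, cappedVal_bits]
  exact if_neg (by rw [decide_eq_true_eq]; omega)

theorem kernel_of_le_length (h : k ≤ l.length) : kernel ((n, l), k.bits) =
    if fits k (reduce n (cancelPairs conflict l)) then
      (reduce n (cancelPairs conflict l), k.bits)
    else ((0, []), []) := by
  simp only [kernel, cappedVal_bits, Nat.min_eq_right (Nat.le_succ_of_le h), h, decide_true,
    if_true]

end

theorem encodeParam_encode (F : CNF) (k : ℕ) :
    encodeParam CNF.encode (F, k) = toData ((F.numVars, F.raw), k.bits) := by
  rw [encodeParam, CNF.encode_eq_toData]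
  rfl

theorem exists_reduced (F : CNF) :
    ∃ F' : CNF, (F'.numVars, F'.raw) = reduce F.numVars (cancelPairs conflict F.raw) ∧
      ConflictFree F'.raw ∧ IsOwned F'.numVars F'.raw ∧
      ∀ k, (F, k) ∈ SATAboveHalf ↔ (F', k) ∈ SATAboveHalf := by
  have h_raw : IsRawCNF F.numVars (cancelPairs conflict F.raw) := fun c hc =>
    CNF.isRawCNF_raw c ((cancelPairs_sublist _).subset hc)
  have h_length := fun c hc => (h_raw c hc).1
  obtain ⟨F', h_eq⟩ := CNF.exists_raw_eq (isRawCNF_reduce h_raw)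
  obtain ⟨h_vars, h_clauses⟩ := Prod.ext_iff.1 h_eq
  simp only at h_vars h_clauses
  refine ⟨F', h_eq, ?_, ?_, fun k => ?_⟩
  · exact h_clauses ▸ conflictFree_reduce h_length (conflictFree_cancelPairs _)
  · exact h_vars ▸ h_clauses ▸ isOwned_reduce _ _
  · rw [mem_satAboveHalf_iff_aboveHalf, mem_satAboveHalf_iff_aboveHalf, h_clauses,
      aboveHalf_reduce h_length, aboveHalf_cancelPairs]

theorem mem_satAboveHalf_empty {k : ℕ} : (CNF.empty, k) ∈ SATAboveHalf ↔ k = 0 := by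
  simp [mem_satAboveHalf_iff, CNF.numClauses, CNF.sat, CNF.numSat, CNF.empty]

theorem exists_encodeParam_eq_kernel (x : CNF × ℕ) : ∃ y : CNF × ℕ,
    encodeParam CNF.encode y = toData (kernel ((x.1.numVars, x.1.raw), x.2.bits)) ∧
    (x ∈ SATAboveHalf ↔ y ∈ SATAboveHalf) ∧ y.2 ≤ x.2 ∧ y.1.numVars ≤ 4 * x.2 ∧
    (y.1.numClauses : ℝ) ≤ (2 * √5 + 4) * x.2 := by
  obtain ⟨F, k⟩ := x
  dsimp only
  have h_empty : (CNF.empty.numClauses : ℝ) ≤ (2 * √5 + 4) * k := by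
    rw [CNF.numClauses, CNF.empty, List.length_nil, Nat.cast_zero]
    positivity
  rcases lt_or_ge F.numClauses k with h_lt | h_le
  · refine ⟨(CNF.empty, 1), ?_, ?_, Nat.one_le_of_lt h_lt, Nat.zero_le _, h_empty⟩
    · rw [kernel_of_length_lt (F.length_raw.trans_lt h_lt), encodeParam_encode, Nat.one_bits]
      rfl
    · exact iff_of_false (fun h => h_lt.not_ge (le_numClauses_of_mem_satAboveHalf h))
        fun h => one_ne_zero (mem_satAboveHalf_empty.1 h)
  obtain ⟨F', h_eq, h_free, h_owned, h_iff⟩ := exists_reduced F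
  rw [kernel_of_le_length (h_le.trans_eq F.length_raw.symm), ← h_eq, h_iff]
  split_ifs with h_fits
  · obtain ⟨h_vars, h_clauses⟩ := fits_iff.1 h_fits
    exact ⟨(F', k), encodeParam_encode F' k, Iff.rfl, le_rfl, h_vars, F'.length_raw ▸ h_clauses⟩
  · refine ⟨(CNF.empty, 0), ?_, iff_of_true ?_ (mem_satAboveHalf_empty.2 rfl), Nat.zero_le _,
      Nat.zero_le _, h_empty⟩
    · rw [encodeParam_encode, Nat.zero_bits]
      rfl
    · rw [fits_iff, not_and_or, not_le, not_le, CNF.length_raw] at h_fits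
      exact h_fits.elim (mem_satAboveHalf_of_lt_numVars h_free h_owned)
        (mem_satAboveHalf_of_lt_numClauses h_free)

theorem dataSize_list_le {α : Type} [DataEncoding α] {l : List α} {N : ℕ}
    (h : ∀ a ∈ l, dataSize a ≤ N) : dataSize l ≤ l.length * (N + 1) + 1 := by
  induction l with
  | nil => simp
  | cons a l ih =>
    rw [List.forall_mem_cons] at h
    have := ih h.2
    rw [dataSize_cons, List.length_cons, Nat.succ_mul]
    omega

theorem size_encode_le (F : CNF) :
    F.encode.size ≤ 2 * F.numVars + F.numClauses * (8 * F.numVars + 2) + 3 := by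
  have h_literals (p : Bool × Bool) : dataSize p ≤ 7 := by
    have h_fst := dataSize_bool_le p.1
    have h_snd := dataSize_bool_le p.2
    rw [← Prod.mk.eta (p := p), dataSize_prodMk]
    omega
  have h_clause : ∀ c ∈ F.raw, dataSize c ≤ 8 * F.numVars + 1 := fun c hc => by
    have := dataSize_list_le fun p (_ : p ∈ c) => h_literals p
    rwa [(CNF.isRawCNF_raw c hc).1, mul_comm] at this
  have h_clauses : dataSize F.raw ≤ F.numClauses * (8 * F.numVars + 2) + 1 :=
    F.length_raw ▸ dataSize_list_le h_clause
  rw [CNF.encode_eq_toData, ← dataSize, dataSize_prodMk, dataSize_nat]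
  omega

theorem two_mul_sqrt_five_add_four_le : 2 * √5 + 4 ≤ 8.473 := by
  have : √5 ≤ 2.2365 := Real.sqrt_le_iff.2 ⟨by norm_num, by norm_num⟩
  linarith

end SATKernel

theorem mainTheorem5 :
    (∃ κ : SATKernel.CNF × ℕ → SATKernel.CNF × ℕ,
      SATKernel.IsProperKernelization SATKernel.CNF.encode SATKernel.SATAboveHalf κ ∧
      ∀ (F : SATKernel.CNF) (k : ℕ),
        (κ (F, k)).1.numVars ≤ 4 * k ∧
        ((κ (F, k)).1.numClauses : ℝ) ≤ (2 * Real.sqrt 5 + 4) * (k : ℝ)) ∧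
    (∀ k : ℕ, (2 * Real.sqrt 5 + 4) * (k : ℝ) ≤ 8.473 * (k : ℝ)) := by
  have clause_bound (k : ℕ) : (2 * √5 + 4) * (k : ℝ) ≤ 8.473 * k :=
    mul_le_mul_of_nonneg_right SATKernel.two_mul_sqrt_five_add_four_le k.cast_nonneg
  refine ⟨?_, clause_bound⟩
  choose κ h_encode h_iff h_param h_vars h_clauses using SATKernel.exists_encodeParam_eq_kernel
  refine ⟨κ, ⟨?_, h_iff, h_param, fun k => 2 * (4 * k) + 9 * k * (8 * (4 * k) + 2) + 3,
    fun x => ?_⟩, fun F k => ⟨h_vars (F, k), h_clauses (F, k)⟩⟩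
  · obtain ⟨p, P, h_runs⟩ := SATKernel.polyTime_kernel
    refine ⟨p, P, fun x => ?_⟩
    rw [h_encode, SATKernel.encodeParam_encode]
    exact h_runs _
  · have h_clauses_nat : (κ x).1.numClauses ≤ 9 * x.2 := by
      rw [← @Nat.cast_le ℝ]
      push_cast
      linarith [h_clauses x, clause_bound x.2, x.2.cast_nonneg (α := ℝ)]
    refine (SATKernel.size_encode_le _).trans ?_
    dsimp only
    gcongr
    all_goals exact h_vars x
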